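/- Let $n_2,n_3\ge 0$ be integers and let $G$ be the group of Hamming-distance-preserving bijections of the set $[2]^{n_2}[3]^{n_3}$ of mixed binary/ternary words. A code is a set of words, and for a code $D$ of size at most $3$, $S(D)$ is the set of codes $C\supseteq D$ with $|C|\le 3$ and $|D|+2|C\setminus D|\le 3$; the subgroup $G_D=\{g\in G: g(D)=D\}$ acts on $S(D)$ by $C\mapsto g(C)$. Thus $S(\emptyset)$ consists of $\emptyset$ and the singletons. *Representative sets.* Let a finite group $\Gamma$ act on a finite set $X$, hence on $K^X$ by $(g\cdot f)(x)=f(g^{-1}x)$, for $K\in\{\mathbb R,\mathbb C\}$. A family of matrices $U_i=[u_{i,1},\dots,u_{i,m_i}]$ ($i=1,\dots,k$, $m_i\ge 1$) with columns in $K^X$ is a representative set for the action of $\Gamma$ on $K^X$ if $K^X$ is an orthogonal direct sum of irreducible $\Gamma$-submodules $V_{i,j}$ ($1\le i\le k$, $1\le j\le m_i$), where $V_{i,j}\cong V_{i',j'}$ if and only if $i=i'$, such that $0\ne u_{i,j}\in V_{i,j}$ and for all $i,j,j'$ there is a $\Gamma$-isomorphism $V_{i,j}\to V_{i,j'}$ mapping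 $u_{i,j}$ to $u_{i,j'}$. Real matrices are called a representative set for the action on $\mathbb R^X$ if they form one over $K=\mathbb R$ and, read as complex matrices, over $K=\mathbb C$. *Tableau vectors.* For a partition $\lambda\vdash n$ with Ferrers diagram $Y(\lambda)$, let $T_{\lambda,m}$ be the set of semistandard tableaux $\tau:Y(\lambda)\to[m]$ (rows nondecreasing, columns increasing). For $B=[B(1),\dots,B(m)]$ with $B(i)\in\mathbb R^q$ put $$u_{\tau,B}=\sum_{\tau'\sim\tau}\ \sum_{c\in C_\lambda}\operatorname{sgn}(c)\bigotimes_{y\in Y(\lambda)}B(\tau'(c(y)))\in(\mathbb R^q)^{\otimes n}=\mathbb R^{[q]^n},$$ where $\sim$ is row equivalence of tableaux, $C_\lambda$ is the column stabilizer, and $Y(\lambda)$ is ordered by concatenating its rows. With unit vectors $e_1,e_2$ of $\mathbb R^{[2]}$ and $f_1,f_2,f_3$ of $\mathbb R^{[3]}$, let $B_1=[e_1+e_2]$, $B_2=[e_1-e_2]$, $B_3=[f_1+f_2+f_3]$, $B_4=[f_1-f_2]$. For $\mathbf n=(l_1,l_2,l_3,l_4)\in\mathbb Z_{\ge0}^4$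 with $l_1+l_2=n_2$, $l_3+l_4=n_3$ and $\pmb\lambda=(\lambda_1,\dots,\lambda_4)$ with $\lambda_i\vdash l_i$, let $Z_{\pmb\lambda}=\prod_{i=1}^4T_{\lambda_i,1}$ and, for $\pmb\tau\in Z_{\pmb\lambda}$, $v_{\pmb\tau}=\bigotimes_{i=1}^4u_{\tau_i,B_i}\in\mathbb R^{[2]^{n_2}[3]^{n_3}}$. **Proposition.** 1. $G_\emptyset=G$, and the natural homomorphism from $(S_2^{n_2}\rtimes S_{n_2})\times(S_3^{n_3}\rtimes S_{n_3})$ to the permutations of $[2]^{n_2}[3]^{n_3}$ (permuting coordinates and the letters in each coordinate) is injective with image $G$. 2. The matrices $[v_{\pmb\tau}\mid\pmb\tau\in Z_{\pmb\lambda}]$, over all such $\mathbf n$ and $\pmb\lambda$ with $Z_{\pmb\lambda}\neq\emptyset$, form a representative set for the action of $G_\emptyset$ on $\mathbb R^{[2]^{n_2}[3]^{n_3}}$. 3. Identify $\mathbb R^{[2]^{n_2}[3]^{n_3}}$ with a subspace of $\mathbb R^{S(\emptyset)}$ by $e_v\mapsto e_{\{v\}}$. After the column $e_\emptyset$ is added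 to the matrix with index $\mathbf n=(n_2,0,n_3,0)$, $\pmb\lambda=((n_2),(),(n_3),())$, the matrices of part 2 form a representative set for the action of $G_\emptyset$ on $\mathbb R^{S(\emptyset)}$. -/

import Mathlib

namespace MixedCode

/-! ### Representative sets -/

/-- The permutation representation of `G` on `𝕜^X`: `(g · f)(x) = f(g⁻¹ · x)`. -/
def permRep (𝕜 : Type*) [Field 𝕜] (G X : Type*) [Group G] [MulAction G X] :
    Representation 𝕜 G (X → 𝕜) where
  toFun g := LinearMap.funLeft 𝕜 𝕜 (fun x => g⁻¹ • x)
  map_one' := by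
    ext f x
    simp [LinearMap.funLeft_apply]
  map_mul' g h := by
    refine LinearMap.ext fun f => funext fun x => ?_
    simp [LinearMap.funLeft_apply, mul_smul]

/-- `U` is a family of matrices `U i = [u i j | j ∈ J i]` with columns in `V = 𝕜^X`, on which `G`
acts through the unitary representation `ρ`. It is a representative set if `V` is the orthogonal
direct sum of irreducible submodules `W i j` (with `J i` nonempty for every `i`) such that
`W i j` and `W i' j'` are isomorphic exactly when `i = i'`, such that `u i j` is a nonzero vector of
`W i j`, and such that for all `j, j'` some `G`-isomorphism from `W i j` to `W i j'` maps
`u i j` to `u i j'`. -/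
def IsRepresentativeSet {𝕜 : Type*} [RCLike 𝕜] {G X : Type*} [Group G] [Fintype X]
    (ρ : Representation 𝕜 G (X → 𝕜)) {ι : Type*} {J : ι → Type*}
    (U : ∀ i, Matrix X (J i) 𝕜) : Prop :=
  (∀ i, Nonempty (J i)) ∧
  ∃ W : ∀ i, J i → Subrepresentation ρ,
    (∀ i j, (W i j).toRepresentation.IsIrreducible) ∧
    (∀ i j i' j', (⟨i, j⟩ : Σ i, J i) ≠ ⟨i', j'⟩ →
      ∀ v ∈ W i j, ∀ w ∈ W i' j', star v ⬝ᵥ w = 0) ∧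
    (⨆ i, ⨆ j, (W i j).toSubmodule) = ⊤ ∧
    (∀ i j i' j',
      Nonempty ((W i j).toRepresentation.Equiv (W i' j').toRepresentation) ↔ i = i') ∧
    ∃ hU : ∀ i j, (U i).col j ∈ (W i j).toSubmodule,
      (∀ i j, (U i).col j ≠ 0) ∧
      ∀ i j j', ∃ φ : (W i j).toRepresentation.Equiv (W i j').toRepresentation,
        φ.toLinearEquiv ⟨(U i).col j, hU i j⟩ = ⟨(U i).col j', hU i j'⟩

/-- Real matrices that form a representative set for the action of `G` on `ℝ^X` and also, read as
complex matrices, for the action of `G` on `ℂ^X`. -/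
def IsRealRepresentativeSet (G X : Type*) [Group G] [MulAction G X] [Fintype X]
    {ι : Type*} {J : ι → Type*} (U : ∀ i, Matrix X (J i) ℝ) : Prop :=
  IsRepresentativeSet (permRep ℝ G X) U ∧
  IsRepresentativeSet (permRep ℂ G X) (fun i => (U i).map (fun r : ℝ => (r : ℂ)))

/-! ### Tableaux; rows and columns of a cell are its first and second coordinates -/

/-- Row stabilizer of a Ferrers diagram. -/
def rowStabilizer (μ : YoungDiagram) : Subgroup (Equiv.Perm μ.cells) where
  carrier := {π | ∀ y, (π y).1.1 = y.1.1}
  one_mem' := by intro y; rfl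
  mul_mem' := by
    intro a b ha hb y
    rw [Equiv.Perm.mul_apply, ha, hb]
  inv_mem' := by
    intro a ha y
    rw [← ha (a⁻¹ y), ← Equiv.Perm.mul_apply, mul_inv_cancel, Equiv.Perm.one_apply]

/-- Column stabilizer of a Ferrers diagram. -/
def columnStabilizer (μ : YoungDiagram) : Subgroup (Equiv.Perm μ.cells) where
  carrier := {π | ∀ y, (π y).1.2 = y.1.2}
  one_mem' := by intro y; rfl
  mul_mem' := by
    intro a b ha hb y
    rw [Equiv.Perm.mul_apply, ha, hb]
  inv_mem' := by
    intro a ha y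
    rw [← ha (a⁻¹ y), ← Equiv.Perm.mul_apply, mul_inv_cancel, Equiv.Perm.one_apply]

/-- A Young tableau with entries in an `m`-element ordered set. -/
abbrev Tableau (μ : YoungDiagram) (m : ℕ) : Type := μ.cells → Fin m

def RowEquivalent {μ : YoungDiagram} {m : ℕ} (τ τ' : Tableau μ m) : Prop :=
  ∃ π ∈ rowStabilizer μ, τ' = τ ∘ π

/-- Rows are nondecreasing and columns are increasing. -/
def IsSemistandard {μ : YoungDiagram} {m : ℕ} (τ : Tableau μ m) : Prop :=
  (∀ y y' : μ.cells, y.1.1 = y'.1.1 → y.1.2 ≤ y'.1.2 → τ y ≤ τ y') ∧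
  (∀ y y' : μ.cells, y.1.2 = y'.1.2 → y.1.1 < y'.1.1 → τ y < τ y')

/-- The set `T_{μ,m}` of semistandard tableaux. -/
abbrev SemistandardTableau (μ : YoungDiagram) (m : ℕ) : Type :=
  {τ : Tableau μ m // IsSemistandard τ}

/-- A partition of `n`, given by its Ferrers diagram. -/
abbrev Partn (n : ℕ) : Type := {μ : YoungDiagram // μ.card = n}

/-- The partition `(n)` of `n` with a single row (the empty partition if `n = 0`). -/
def rowPartn (n : ℕ) : Partn n :=
  ⟨{ cells := {0} ×ˢ Finset.range n
     isLowerSet := by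
       rintro ⟨a, b⟩ ⟨c, d⟩ h hab
       simp only [Prod.mk_le_mk] at h
       simp only [Finset.coe_product, Set.mem_prod, Finset.mem_coe, Finset.mem_singleton,
         Finset.mem_range] at hab ⊢
       omega },
    by simp [YoungDiagram.card]⟩

/-- The `k`-th cell of the diagram when its rows are concatenated, starting from the first row:
the cells are listed lexicographically by row and then column. -/
def readingCell {n : ℕ} (lam : Partn n) (k : Fin n) : lam.1.cells :=
  ⟨ofLex ((lam.1.cells.map (toLex (α := ℕ × ℕ)).toEmbedding).orderEmbOfFin
      (by rw [Finset.card_map]; exact lam.2) k), by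
    have h := Finset.orderEmbOfFin_mem (lam.1.cells.map (toLex (α := ℕ × ℕ)).toEmbedding)
      (by rw [Finset.card_map]; exact lam.2) k
    simpa using h⟩

open Classical in
/-- `u_{τ,B} = ∑_{τ' ∼ τ} ∑_{c ∈ C_λ} sgn(c) ⨂_{y ∈ Y(λ)} B(τ'(c y))` in `(ℝ^q)^{⊗ n}`, for
`B = [B(1), …, B(m)]`. The space `(ℝ^q)^{⊗ n}` is identified with the functions on words of
length `n` over `q` letters, so that `(w_1 ⊗ ⋯ ⊗ w_n)(x) = w_1(x_1) ⋯ w_n(x_n)`. -/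
noncomputable def tableauVector {n m q : ℕ} (lam : Partn n) (B : Fin m → Fin q → ℝ)
    (τ : Tableau lam.1 m) : (Fin n → Fin q) → ℝ := fun x =>
  ∑ τ' : Tableau lam.1 m with RowEquivalent τ τ', ∑ c : columnStabilizer lam.1,
    ((Equiv.Perm.sign c.1 : ℤ) : ℝ) * ∏ k : Fin n, B (τ' (c.1 (readingCell lam k))) (x k)

/-! ### Mixed words, isometries, codes -/

/-- The words in `[2]^{n₂}[3]^{n₃}`. -/
abbrev Word (n₂ n₃ : ℕ) : Type := (Fin n₂ → Fin 2) × (Fin n₃ → Fin 3)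

/-- The number of positions in which two mixed words differ. -/
def wordDist {n₂ n₃ : ℕ} (v w : Word n₂ n₃) : ℕ :=
  hammingDist v.1 w.1 + hammingDist v.2 w.2

/-- The group of distance-preserving bijections of `[2]^{n₂}[3]^{n₃}`. -/
def isometryGroup (n₂ n₃ : ℕ) : Subgroup (Equiv.Perm (Word n₂ n₃)) where
  carrier := {g | ∀ v w, wordDist (g v) (g w) = wordDist v w}
  one_mem' := by intro v w; rfl
  mul_mem' := by
    intro a b ha hb v w
    rw [Equiv.Perm.mul_apply, Equiv.Perm.mul_apply, ha, hb]
  inv_mem' := by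
    intro a ha v w
    rw [← ha (a⁻¹ v) (a⁻¹ w), ← Equiv.Perm.mul_apply, ← Equiv.Perm.mul_apply, mul_inv_cancel,
      Equiv.Perm.one_apply, Equiv.Perm.one_apply]

/-- A code: a set of words. -/
abbrev Code (n₂ n₃ : ℕ) : Type := Finset (Word n₂ n₃)

/-- The subgroup `G_D` of isometries that leave the code `D` invariant. -/
def codeStabilizer {n₂ n₃ : ℕ} (D : Code n₂ n₃) : Subgroup (Equiv.Perm (Word n₂ n₃)) where
  carrier := {g | g ∈ isometryGroup n₂ n₃ ∧ D.map g.toEmbedding = D}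
  one_mem' := ⟨Subgroup.one_mem _, Finset.map_refl⟩
  mul_mem' := by
    rintro a b ⟨ha, ha'⟩ ⟨hb, hb'⟩
    refine ⟨Subgroup.mul_mem _ ha hb, ?_⟩
    have h : (a * b).toEmbedding = b.toEmbedding.trans a.toEmbedding := rfl
    rw [h, ← Finset.map_map, hb', ha']
  inv_mem' := by
    rintro a ⟨ha, ha'⟩
    refine ⟨Subgroup.inv_mem _ ha, ?_⟩
    have h : a.toEmbedding.trans (a⁻¹).toEmbedding = Function.Embedding.refl _ := by
      ext x <;> simp
    conv_lhs => rw [← ha']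
    rw [Finset.map_map, h, Finset.map_refl]

/-- `S(D)` for the parameter `k`: the codes `C ⊇ D` with `|C| ≤ k` and `|D| + 2|C ∖ D| ≤ k`. -/
abbrev CodeFamily {n₂ n₃ : ℕ} (k : ℕ) (D : Code n₂ n₃) : Type :=
  {C : Code n₂ n₃ // C.card ≤ k ∧ D ⊆ C ∧ D.card + 2 * (C \ D).card ≤ k}

/-- `G_D` acts on `S(D)` by `g · C = g(C)`. -/
instance {n₂ n₃ : ℕ} (k : ℕ) (D : Code n₂ n₃) :
    MulAction (codeStabilizer D) (CodeFamily k D) where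
  smul g C := ⟨C.1.map g.1.toEmbedding, by
    have hD := g.2.2
    refine ⟨by rw [Finset.card_map]; exact C.2.1, ?_, ?_⟩
    · conv_lhs => rw [← hD]
      exact Finset.map_subset_map.2 C.2.2.1
    · have h : C.1.map g.1.toEmbedding \ D = (C.1 \ D).map g.1.toEmbedding := by
        have h' : (C.1 \ D).map g.1.toEmbedding =
            C.1.map g.1.toEmbedding \ D.map g.1.toEmbedding := by
          simp only [Finset.map_eq_image]
          exact Finset.image_sdiff _ _ g.1.injective
        rw [h', hD]
      rw [h, Finset.card_map]
      exact C.2.2.2⟩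
  one_smul C := Subtype.ext (by
    exact Finset.map_refl)
  mul_smul a b C := Subtype.ext (by
    show C.1.map (a.1 * b.1).toEmbedding = (C.1.map b.1.toEmbedding).map a.1.toEmbedding
    rw [Finset.map_map]
    rfl)

/-- The wreath product `S_q^n ⋊ S_n`. -/
abbrev Wreath (q n : ℕ) : Type :=
  (Fin n → Equiv.Perm (Fin q)) ⋊[mulAutArrow] Equiv.Perm (Fin n)

/-- `S_q^n ⋊ S_n` acts on `[q]^n` by permuting the coordinates and then the letters in each
coordinate. -/
def wreathPerm (q n : ℕ) : Wreath q n →* Equiv.Perm (Fin n → Fin q) where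
  toFun h :=
    { toFun := fun x i => h.left i (x (h.right⁻¹ i))
      invFun := fun x i => (h.left (h.right i))⁻¹ (x (h.right i))
      left_inv := by intro x; funext i; simp
      right_inv := by intro x; funext i; simp }
  map_one' := by ext x i; simp
  map_mul' a b := by
    ext x i
    simp [Equiv.Perm.mul_apply]
    rfl

/-- `(S_2^{n₂} ⋊ S_{n₂}) × (S_3^{n₃} ⋊ S_{n₃})` acting on `[2]^{n₂}[3]^{n₃}`. -/
def mixedPerm (n₂ n₃ : ℕ) : Wreath 2 n₂ × Wreath 3 n₃ →* Equiv.Perm (Word n₂ n₃) where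
  toFun h := Equiv.prodCongr (wreathPerm 2 n₂ h.1) (wreathPerm 3 n₃ h.2)
  map_one' := by ext v <;> simp
  map_mul' a b := by ext v <;> simp

/-! ### The matrices -/

/-- `B₁ = [e₁ + e₂]`. -/
def B₁ : Fin 1 → Fin 2 → ℝ := fun _ => ![1, 1]
/-- `B₂ = [e₁ - e₂]`. -/
def B₂ : Fin 1 → Fin 2 → ℝ := fun _ => ![1, -1]
/-- `B₃ = [f₁ + f₂ + f₃]`. -/
def B₃ : Fin 1 → Fin 3 → ℝ := fun _ => ![1, 1, 1]
/-- `B₄ = [f₁ - f₂]`. -/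
def B₄ : Fin 1 → Fin 3 → ℝ := fun _ => ![1, -1, 0]

/-- The pairs of a quadruple `(l₁, l₂, l₃, l₄)` with `l₁ + l₂ = n₂` and `l₃ + l₄ = n₃`, and a
quadruple of partitions of `l₁, l₂, l₃, l₄`. -/
structure BlockIndex (n₂ n₃ : ℕ) where
  l₁ : ℕ
  l₂ : ℕ
  l₃ : ℕ
  l₄ : ℕ
  sum₂ : l₁ + l₂ = n₂
  sum₃ : l₃ + l₄ = n₃
  lam₁ : Partn l₁
  lam₂ : Partn l₂
  lam₃ : Partn l₃
  lam₄ : Partn l₄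

/-- `Z_λ`, the product of the sets `T_{λ_i,1}`. -/
abbrev BlockIndex.Z {n₂ n₃ : ℕ} (p : BlockIndex n₂ n₃) : Type :=
  SemistandardTableau p.lam₁.1 1 × SemistandardTableau p.lam₂.1 1 ×
    SemistandardTableau p.lam₃.1 1 × SemistandardTableau p.lam₄.1 1

/-- `v_τ`, the tensor product of the four vectors `u_{τ_i,B_i}`; the first `l₁` binary coordinates
belong to `B₁`, the last `l₂` to `B₂`, the first `l₃` ternary ones to `B₃`, the last `l₄` to
`B₄`. -/
noncomputable def blockVector {n₂ n₃ : ℕ} (p : BlockIndex n₂ n₃) (τ : p.Z) :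
    Word n₂ n₃ → ℝ := fun x =>
  tableauVector p.lam₁ B₁ τ.1.1 (fun k => x.1 (Fin.cast p.sum₂ (Fin.castAdd p.l₂ k))) *
  tableauVector p.lam₂ B₂ τ.2.1.1 (fun k => x.1 (Fin.cast p.sum₂ (Fin.natAdd p.l₁ k))) *
  tableauVector p.lam₃ B₃ τ.2.2.1.1 (fun k => x.2 (Fin.cast p.sum₃ (Fin.castAdd p.l₄ k))) *
  tableauVector p.lam₄ B₄ τ.2.2.2.1 (fun k => x.2 (Fin.cast p.sum₃ (Fin.natAdd p.l₃ k)))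

/-- The index `((n₂), (), (n₃), ())` of `(n₂, 0, n₃, 0)`. -/
def invariantIndex (n₂ n₃ : ℕ) : BlockIndex n₂ n₃ where
  l₁ := n₂
  l₂ := 0
  l₃ := n₃
  l₄ := 0
  sum₂ := rfl
  sum₃ := rfl
  lam₁ := rowPartn n₂
  lam₂ := rowPartn 0
  lam₃ := rowPartn n₃
  lam₄ := rowPartn 0

/-- The indices whose matrix has at least one column. -/
abbrev NonemptyBlock (n₂ n₃ : ℕ) : Type := {p : BlockIndex n₂ n₃ // Nonempty p.Z}

/-- The matrix `[v_τ | τ ∈ Z_λ]`. -/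
noncomputable def blockMatrix {n₂ n₃ : ℕ} (p : NonemptyBlock n₂ n₃) :
    Matrix (Word n₂ n₃) p.1.Z ℝ :=
  Matrix.of fun x τ => blockVector p.1 τ x

/-- The inclusion of `ℝ^{[2]^{n₂}[3]^{n₃}}` in `ℝ^{S(∅)}` that maps `e_v` to `e_{{v}}`. -/
noncomputable def singletonExtension {n₂ n₃ : ℕ} (f : Word n₂ n₃ → ℝ) :
    CodeFamily 3 (∅ : Code n₂ n₃) → ℝ := fun C =>
  ∑ v : Word n₂ n₃, if C.1 = {v} then f v else 0

/-- The unit vector `e_∅` of `ℝ^{S(∅)}`. -/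
noncomputable def emptyVector (n₂ n₃ : ℕ) : CodeFamily 3 (∅ : Code n₂ n₃) → ℝ := fun C =>
  if C.1 = ∅ then 1 else 0

/-- The columns of the matrices for `ℝ^{S(∅)}`: the set `Z_λ`, with one more column if
`λ = ((n₂), (), (n₃), ())`. -/
abbrev ExtendedColumn {n₂ n₃ : ℕ} (p : NonemptyBlock n₂ n₃) : Type :=
  p.1.Z ⊕ PLift (p.1 = invariantIndex n₂ n₃)

/-- The matrix `[v_τ | τ ∈ Z_λ]`, with the column `e_∅` added if `λ = ((n₂), (), (n₃), ())`. -/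
noncomputable def extendedMatrix {n₂ n₃ : ℕ} (p : NonemptyBlock n₂ n₃) :
    Matrix (CodeFamily 3 (∅ : Code n₂ n₃)) (ExtendedColumn p) ℝ :=
  Matrix.of fun C t => Sum.elim
    (fun τ => singletonExtension (blockVector p.1 τ) C) (fun _ => emptyVector n₂ n₃ C) t

end MixedCode

/-!
A semistandard tableau with a single letter exists only on a one-row diagram, where its tableau
vector is the tensor power of the only vector of `B`. So every nonempty block has a single column,
determined by `l₁` and `l₃`: up to a split of the coordinates it is the tensor product of `l₁`
all-ones vectors and `l₂` vectors `e_0 - e_1` over the binary alphabet, and of `l₃` all-ones vectors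
and `l₄` vectors `e_0 - e_1` over the ternary one (`wordVec`, `blockVector_eq`).

The two alphabets are treated alike, since for every `q ≥ 2` the operators `v vᵀ` on `ℝ^q`, for `v`
the all-ones vector or `e_0 - e_1`, lie in the group algebra of `S_q`: they are the sum of the
cyclic shifts of the letters and `1 - (0 1)`. Taking tensor products, `v vᵀ` lies in the group
algebra of `G` for every block vector `v` (`wordVec_kernel`, `IsKernelFamily.prod`). This replaces
character theory. Let `W` be the module generated by `v`. A nonzero `f` in `W` is not orthogonal to
all translates of `v`, so `v vᵀ` maps a translate of `f` to a nonzero multiple of `v`; hence every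
nonzero submodule of `W` contains `v`, and `W` is irreducible. Modules of different block vectors
are orthogonal, by counting the coordinates at which the two tensors are of different kinds, so
`v vᵀ` vanishes on the other modules but not on `W`, and they are not isomorphic to `W`. The modules
generate the whole space because unit vectors of words expand into tensor products of all-ones
vectors and differences `e_c - e_d`. The argument is the same over `ℝ` and `ℂ`
(`isRepresentativeSet_of_kernels`).

In `S(∅)` there is one more orbit, the fixed point `∅`. The group algebra element of `v` acts on its
unit vector by the sum of its coefficients, which is zero except for the all-ones vector, so the
unit vector only joins the block of the trivial representation
(`IsKernelFamily.isRepresentativeSet_option`).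

That `G` is the image of the wreath products is shown through the words at distance one from the
zero word: an isometry that fixes the zero word permutes them, keeping the binary ones apart from
the ternary ones since only the latter lie in triangles with the zero word, and is determined by
this permutation (`eq_one_of_fix_atoms`, `range_mixedPerm`).
-/

namespace MixedCode

/-! ### Cyclic subrepresentations -/

section Cyclic

variable {𝕜 G V : Type*} [Field 𝕜] [Group G] [AddCommGroup V] [Module 𝕜 V]

/-- The subrepresentation generated by a vector `v`. -/
def orbitSpan (ρ : Representation 𝕜 G V) (v : V) : Subrepresentation ρ where
  toSubmodule := Submodule.span 𝕜 (Set.range fun g => ρ g v)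
  apply_mem_toSubmodule g w hw := by
    induction hw using Submodule.span_induction with
    | mem x hx =>
      obtain ⟨h, rfl⟩ := hx
      refine Submodule.subset_span ⟨g * h, ?_⟩
      simp
    | zero => simp
    | add x y _ _ hx hy => rw [map_add]; exact Submodule.add_mem _ hx hy
    | smul a x _ hx => rw [map_smul]; exact Submodule.smul_mem _ a hx

theorem apply_mem_orbitSpan (ρ : Representation 𝕜 G V) (g : G) (v : V) :
    ρ g v ∈ (orbitSpan ρ v).toSubmodule :=
  Submodule.subset_span ⟨g, rfl⟩

theorem self_mem_orbitSpan (ρ : Representation 𝕜 G V) (v : V) :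
    v ∈ (orbitSpan ρ v).toSubmodule := by
  simpa using apply_mem_orbitSpan ρ 1 v

theorem orbitSpan_le {ρ : Representation 𝕜 G V} {v : V} {M : Submodule 𝕜 V}
    (hM : ∀ g, ρ g v ∈ M) : (orbitSpan ρ v).toSubmodule ≤ M :=
  Submodule.span_le.2 (by rintro _ ⟨g, rfl⟩; exact hM g)

/-- A cyclic representation is irreducible if its generator can be recovered from every nonzero
vector. -/
theorem isIrreducible_orbitSpan {ρ : Representation 𝕜 G V} {v : V} (hv : v ≠ 0)
    (h : ∀ f ∈ (orbitSpan ρ v).toSubmodule, f ≠ 0 → v ∈ (orbitSpan ρ f).toSubmodule) :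
    (orbitSpan ρ v).toRepresentation.IsIrreducible := by
  refine { exists_pair_ne := ⟨⊥, ⊤, ?_⟩, eq_bot_or_eq_top := ?_ }
  · intro hbt
    have hmem : (⟨v, self_mem_orbitSpan ρ v⟩ : (orbitSpan ρ v).toSubmodule) ∈
        (⊥ : Subrepresentation (orbitSpan ρ v).toRepresentation).toSubmodule := by
      rw [hbt]; exact Submodule.mem_top
    exact hv (congrArg Subtype.val ((Submodule.mem_bot 𝕜).1 hmem))
  · intro M
    by_cases hM : ∃ f ∈ M.toSubmodule, f ≠ 0
    · obtain ⟨f, hfM, hf⟩ := hM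
      right
      have hle : (orbitSpan ρ f.1).toSubmodule ≤
          M.toSubmodule.map (orbitSpan ρ v).toSubmodule.subtype :=
        orbitSpan_le fun g => ⟨_, M.apply_mem_toSubmodule g hfM, rfl⟩
      have hle' : (orbitSpan ρ v).toSubmodule ≤
          M.toSubmodule.map (orbitSpan ρ v).toSubmodule.subtype := by
        obtain ⟨w, hw, hwv⟩ := hle (h f.1 f.2 fun h0 => hf (Subtype.ext h0))
        refine orbitSpan_le fun g => ⟨_, M.apply_mem_toSubmodule g hw, ?_⟩
        exact congrArg (ρ g) hwv
      refine Subrepresentation.toSubmodule_injective (eq_top_iff.2 fun x _ => ?_)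
      obtain ⟨w, hw, hwx⟩ := hle' x.2
      rwa [← show w = x from Subtype.ext hwx]
    · left
      push Not at hM
      exact Subrepresentation.toSubmodule_injective
        ((Submodule.eq_bot_iff M.toSubmodule).2 hM)

/-- An operator in the group algebra maps a vector into the subrepresentation that it
generates. -/
theorem groupAlgebra_apply_mem_orbitSpan {ρ : Representation 𝕜 G V} {A : Module.End 𝕜 V}
    (hA : A ∈ Submodule.span 𝕜 (Set.range ρ)) (f : V) : A f ∈ (orbitSpan ρ f).toSubmodule := by
  induction hA using Submodule.span_induction with
  | mem x hx => obtain ⟨g, rfl⟩ := hx; exact apply_mem_orbitSpan ρ g f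
  | zero => exact Submodule.zero_mem _
  | add x y _ _ hx hy => exact Submodule.add_mem _ hx hy
  | smul a x _ hx => exact Submodule.smul_mem _ a hx

/-- Isomorphisms of subrepresentations commute with the operators in the group algebra. -/
theorem groupAlgebra_apply_equiv {ρ : Representation 𝕜 G V} {A : Module.End 𝕜 V}
    (hA : A ∈ Submodule.span 𝕜 (Set.range ρ)) {W W' : Subrepresentation ρ}
    (e : W.toRepresentation.Equiv W'.toRepresentation) (w : W.toSubmodule) :
    ∃ w' : W.toSubmodule, (w' : V) = A w ∧ (e.toLinearEquiv w' : V) = A (e.toLinearEquiv w) := by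
  induction hA using Submodule.span_induction with
  | mem x hx =>
    obtain ⟨g, rfl⟩ := hx
    refine ⟨W.toRepresentation g w, rfl, ?_⟩
    have h := LinearMap.congr_fun (e.isIntertwining' g) w
    exact congrArg Subtype.val h
  | zero => exact ⟨0, by simp⟩
  | add x y _ _ hx hy =>
    obtain ⟨a, ha, ha'⟩ := hx
    obtain ⟨b, hb, hb'⟩ := hy
    exact ⟨a + b, by simp [ha, hb], by
      rw [map_add, Submodule.coe_add, ha', hb', LinearMap.add_apply]⟩
  | smul c x _ hx =>
    obtain ⟨a, ha, ha'⟩ := hx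
    exact ⟨c • a, by simp [ha], by
      rw [map_smul, Submodule.coe_smul, ha', LinearMap.smul_apply]⟩

/-- Intertwining operators that exchange two generators give an isomorphism of the cyclic
subrepresentations. -/
theorem exists_equiv_orbitSpan {ρ : Representation 𝕜 G V} {v w : V} {T S : Module.End 𝕜 V}
    (hT : ∀ g f, T (ρ g f) = ρ g (T f)) (hS : ∀ g f, S (ρ g f) = ρ g (S f))
    (hTv : T v = w) (hSw : S w = v) :
    ∃ φ : (orbitSpan ρ v).toRepresentation.Equiv (orbitSpan ρ w).toRepresentation,
      φ.toLinearEquiv ⟨v, self_mem_orbitSpan ρ v⟩ = ⟨w, self_mem_orbitSpan ρ w⟩ := by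
  have maps : ∀ {T : Module.End 𝕜 V} {v w : V}, (∀ g f, T (ρ g f) = ρ g (T f)) → T v = w →
      ∀ x ∈ (orbitSpan ρ v).toSubmodule, T x ∈ (orbitSpan ρ w).toSubmodule := by
    intro T v w hT hTv
    refine orbitSpan_le (M := (orbitSpan ρ w).toSubmodule.comap T) fun g => ?_
    rw [Submodule.mem_comap, hT, hTv]
    exact apply_mem_orbitSpan ρ g w
  have inv : ∀ {T S : Module.End 𝕜 V} {v w : V}, (∀ g f, T (ρ g f) = ρ g (T f)) →
      (∀ g f, S (ρ g f) = ρ g (S f)) → T v = w → S w = v →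
      ∀ x ∈ (orbitSpan ρ v).toSubmodule, S (T x) = x := by
    intro T S v w hT hS hTv hSw
    refine orbitSpan_le (M := LinearMap.eqLocus (S ∘ₗ T) LinearMap.id) fun g => ?_
    simp [hT, hS, hTv, hSw]
  let e : (orbitSpan ρ v).toSubmodule ≃ₗ[𝕜] (orbitSpan ρ w).toSubmodule :=
    LinearEquiv.ofLinearMap (T.restrict (maps hT hTv)) (S.restrict (maps hS hSw))
      (LinearMap.ext fun x => Subtype.ext (inv hS hT hSw hTv x.1 x.2))
      (LinearMap.ext fun x => Subtype.ext (inv hT hS hTv hSw x.1 x.2))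
  exact ⟨.mk e fun g => LinearMap.ext fun x => Subtype.ext (hT g x.1), Subtype.ext hTv⟩

end Cyclic

/-! ### Representative sets from kernels in the group algebra -/

theorem permRep_apply {𝕜 G X : Type*} [Field 𝕜] [Group G] [MulAction G X] (g : G) (f : X → 𝕜)
    (x : X) : permRep 𝕜 G X g f x = f (g⁻¹ • x) := rfl

/-- A real kernel `k` on `X` lies in the group algebra of `G`, acting by `act`, if it is a linear
combination of permutation matrices of elements of `G`. -/
def IsGroupKernel {G X : Type*} (act : G → X → X) (k : X → X → ℝ) : Prop :=
  ∃ (κ : Type) (_ : Fintype κ) (g : κ → G) (a : κ → ℝ), ∀ x y, by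
    classical exact k x y = ∑ s, if act (g s) y = x then a s else 0

section Kernel

open scoped ComplexOrder

variable {𝕜 G X : Type*} [RCLike 𝕜] [Group G] [MulAction G X] [Fintype X]

/-- A real vector, read as a vector over `𝕜`. -/
def castVec (𝕜 : Type*) [RCLike 𝕜] {X : Type*} (v : X → ℝ) : X → 𝕜 := fun x => (v x : 𝕜)

theorem star_castVec {𝕜 X : Type*} [RCLike 𝕜] (v : X → ℝ) : star (castVec 𝕜 v) = castVec 𝕜 v := by
  ext x; simp [castVec]

/-- The operator on `𝕜^X` with a real kernel. -/
noncomputable def kernelOp (𝕜 : Type*) [RCLike 𝕜] {X : Type*} [Fintype X] (k : X → X → ℝ) :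
    Module.End 𝕜 (X → 𝕜) where
  toFun f x := ∑ y, (k x y : 𝕜) * f y
  map_add' f f' := by ext x; simp [mul_add, Finset.sum_add_distrib]
  map_smul' c f := by ext x; simp [Finset.mul_sum, mul_left_comm]

theorem kernelOp_apply (k : X → X → ℝ) (f : X → 𝕜) (x : X) :
    kernelOp 𝕜 k f x = ∑ y, (k x y : 𝕜) * f y := rfl

theorem kernelOp_mem_span {k : X → X → ℝ} (hk : IsGroupKernel (fun (g : G) x => g • x) k) :
    kernelOp 𝕜 k ∈ Submodule.span 𝕜 (Set.range (permRep 𝕜 G X)) := by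
  classical
  obtain ⟨κ, _, g, a, h⟩ := hk
  have : kernelOp 𝕜 k = ∑ s, (a s : 𝕜) • permRep 𝕜 G X (g s) := by
    refine LinearMap.ext fun f => funext fun x => ?_
    simp only [kernelOp_apply, h, LinearMap.sum_apply, Finset.sum_apply, LinearMap.smul_apply,
      Pi.smul_apply, permRep_apply, smul_eq_mul]
    push_cast
    simp only [Finset.sum_mul]
    rw [Finset.sum_comm]
    refine Finset.sum_congr rfl fun s _ => ?_
    rw [Finset.sum_eq_single ((g s)⁻¹ • x)]
    · simp
    · intro y _ hy
      rw [if_neg (by rintro rfl; simp at hy)]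
      simp
    · simp
  rw [this]
  exact Submodule.sum_mem _ fun s _ => Submodule.smul_mem _ _ (Submodule.subset_span ⟨g s, rfl⟩)

theorem kernelOp_permRep {t : X → X → ℝ} (ht : ∀ (g : G) x y, t (g • x) (g • y) = t x y) (g : G)
    (f : X → 𝕜) : kernelOp 𝕜 t (permRep 𝕜 G X g f) = permRep 𝕜 G X g (kernelOp 𝕜 t f) := by
  ext x
  simp only [kernelOp_apply, permRep_apply]
  rw [← Equiv.sum_comp (MulAction.toPerm g)]
  refine Finset.sum_congr rfl fun y _ => ?_
  simp [← ht g⁻¹ x]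

theorem dotProduct_permRep (g : G) (f f' : X → 𝕜) :
    star (permRep 𝕜 G X g f) ⬝ᵥ f' = star f ⬝ᵥ permRep 𝕜 G X g⁻¹ f' := by
  simp only [dotProduct, permRep_apply, Pi.star_apply]
  rw [← Equiv.sum_comp (MulAction.toPerm g)]
  simp

/-- Real vectors `u i j`, such that the vectors with the same `i` are exchanged by invariant
kernels, vectors with different indices generate orthogonal submodules, all of them generate
`ℝ^X`, and `∑ j, c i j • u i j (u i j)ᵀ` lies in the group algebra for some nonzero `c i j`, form a
representative set. The last kernel maps every nonzero vector of the submodule generated by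
`u i j`, after a translation by the group, to a nonzero multiple of `u i j`, so that this submodule
is irreducible; it vanishes on the submodules with a different `i`, which therefore are not
isomorphic to it. -/
theorem isRepresentativeSet_of_kernels {ι : Type*} {J : ι → Type*} [∀ i, Fintype (J i)]
    (hJ : ∀ i, Nonempty (J i)) (u : ∀ i, Matrix X (J i) ℝ) (c : ∀ i, J i → ℝ)
    (hc : ∀ i j, c i j ≠ 0) (hne : ∀ i j, (u i).col j ≠ 0)
    (horth : ∀ i j i' j', (⟨i, j⟩ : Σ i, J i) ≠ ⟨i', j'⟩ →
      ∀ g : G, ∑ x, u i x j * u i' (g • x) j' = 0)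
    (hker : ∀ i, IsGroupKernel (fun (g : G) x => g • x) fun x y =>
      ∑ j, c i j * (u i x j * u i y j))
    (hspan : ∀ y, (by classical exact Pi.single y (1 : ℝ)) ∈
      Submodule.span ℝ (Set.range fun p : (Σ i, J i) × G => fun x => u p.1.1 (p.2 • x) p.1.2))
    (hiso : ∀ i j j', ∃ t : X → X → ℝ, (∀ (g : G) x y, t (g • x) (g • y) = t x y) ∧
      ∀ x, ∑ y, t x y * u i y j = u i x j') :
    IsRepresentativeSet (permRep 𝕜 G X) (fun i => (u i).map fun r : ℝ => (r : 𝕜)) := by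
  classical
  set ρ := permRep 𝕜 G X with hρ
  let v : ∀ i, J i → X → 𝕜 := fun i j => castVec 𝕜 ((u i).col j)
  have hv : ∀ i j, v i j ≠ 0 := by
    intro i j h
    refine hne i j (funext fun x => ?_)
    have := congrFun h x
    simpa [v, castVec] using this
  have hperp : ∀ i j i' j', (⟨i, j⟩ : Σ i, J i) ≠ ⟨i', j'⟩ →
      ∀ f ∈ (orbitSpan ρ (v i' j')).toSubmodule, star (v i j) ⬝ᵥ f = 0 := by
    intro i j i' j' h
    refine orbitSpan_le (M := LinearMap.ker (dotProductBilin 𝕜 𝕜 (star (v i j)))) fun g => ?_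
    have := congrArg (fun r : ℝ => (r : 𝕜)) (horth i j i' j' h g⁻¹)
    simpa [dotProduct, v, castVec, hρ, permRep_apply] using this
  have hop : ∀ i (f : X → 𝕜), kernelOp 𝕜 (fun x y => ∑ j, c i j * (u i x j * u i y j)) f =
      ∑ j, ((c i j : 𝕜) * (star (v i j) ⬝ᵥ f)) • v i j := by
    intro i f
    ext x
    simp only [v, star_castVec, kernelOp_apply, dotProduct, castVec, Finset.sum_apply,
      Pi.smul_apply, smul_eq_mul, Finset.mul_sum, Finset.sum_mul]
    push_cast
    simp only [Finset.sum_mul]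
    rw [Finset.sum_comm]
    refine Finset.sum_congr rfl fun j _ => Finset.sum_congr rfl fun y _ => ?_
    simp only [Matrix.col_apply]
    ring
  have hop_self : ∀ i j, ∀ f ∈ (orbitSpan ρ (v i j)).toSubmodule,
      kernelOp 𝕜 (fun x y => ∑ j, c i j * (u i x j * u i y j)) f =
        ((c i j : 𝕜) * (star (v i j) ⬝ᵥ f)) • v i j := by
    intro i j f hf
    rw [hop, Finset.sum_eq_single j]
    · intro j' _ hj
      rw [hperp i j' i j (by simpa using hj) f hf, mul_zero, zero_smul]
    · simp
  have hop_other : ∀ i i' j', i ≠ i' → ∀ f ∈ (orbitSpan ρ (v i' j')).toSubmodule,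
      kernelOp 𝕜 (fun x y => ∑ j, c i j * (u i x j * u i y j)) f = 0 := by
    intro i i' j' hi f hf
    rw [hop]
    refine Finset.sum_eq_zero fun j _ => ?_
    rw [hperp i j i' j' (fun h => hi (congrArg Sigma.fst h)) f hf, mul_zero, zero_smul]
  have hc' : ∀ i j, (c i j : 𝕜) ≠ 0 := fun i j => by simpa using hc i j
  have hiso' : ∀ i j j',
      ∃ φ : (orbitSpan ρ (v i j)).toRepresentation.Equiv (orbitSpan ρ (v i j')).toRepresentation,
        φ.toLinearEquiv ⟨v i j, self_mem_orbitSpan ρ _⟩ = ⟨v i j', self_mem_orbitSpan ρ _⟩ := by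
    intro i j j'
    have key : ∀ {j j'} {t : X → X → ℝ}, (∀ x, ∑ y, t x y * u i y j = u i x j') →
        kernelOp 𝕜 t (v i j) = v i j' := by
      intro j j' t ht
      ext x
      simp only [kernelOp_apply, v, castVec, Matrix.col_apply, ← ht]
      push_cast
      rfl
    obtain ⟨t, ht, htu⟩ := hiso i j j'
    obtain ⟨s, hs, hsu⟩ := hiso i j' j
    exact exists_equiv_orbitSpan (kernelOp_permRep ht) (kernelOp_permRep hs) (key htu) (key hsu)
  refine ⟨hJ, fun i j => orbitSpan ρ (v i j), ?_, ?_, ?_, ?_, ?_, ?_, ?_⟩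
  · intro i j
    refine isIrreducible_orbitSpan (hv i j) fun f hf hf0 => ?_
    -- Otherwise `f` is orthogonal to the module that contains it.
    obtain ⟨g, hg⟩ : ∃ g, star (v i j) ⬝ᵥ ρ g f ≠ 0 := by
      by_contra! h
      have : (orbitSpan ρ (v i j)).toSubmodule ≤
          LinearMap.ker (dotProductBilin 𝕜 𝕜 (star f)) := by
        refine orbitSpan_le fun g => ?_
        have h1 : star (ρ g (v i j)) ⬝ᵥ f = 0 := by rw [hρ, dotProduct_permRep]; exact h g⁻¹
        have h2 := congrArg star h1
        rw [← Matrix.star_dotProduct_star, star_star] at h2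
        simpa using h2
      exact hf0 (dotProduct_star_self_eq_zero.1 (by simpa using this hf))
    have hmem := groupAlgebra_apply_mem_orbitSpan (kernelOp_mem_span (𝕜 := 𝕜) (hker i)) (ρ g f)
    rw [hop_self i j _ ((orbitSpan ρ (v i j)).apply_mem_toSubmodule g hf)] at hmem
    have hle : (orbitSpan ρ (ρ g f)).toSubmodule ≤ (orbitSpan ρ f).toSubmodule :=
      orbitSpan_le fun h => (orbitSpan ρ f).apply_mem_toSubmodule h (apply_mem_orbitSpan ρ g f)
    exact (Submodule.smul_mem_iff _ (mul_ne_zero (hc' i j) hg)).1 (hle hmem)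
  · intro i j i' j' h f hf w hw
    have : (orbitSpan ρ (v i' j')).toSubmodule ≤
        LinearMap.ker (dotProductBilin 𝕜 𝕜 (star f)) := by
      refine orbitSpan_le fun g => ?_
      have h1 := hperp i' j' i j (Ne.symm h) _ ((orbitSpan ρ (v i j)).apply_mem_toSubmodule g⁻¹ hf)
      rw [← dotProduct_permRep] at h1
      have h2 := congrArg star h1
      rw [← Matrix.star_dotProduct_star, star_star] at h2
      simpa using h2
    simpa using this hw
  · refine eq_top_iff.2 fun f _ => ?_
    set T := ⨆ i, ⨆ j, (orbitSpan ρ (v i j)).toSubmodule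
    have hsingle : ∀ y, (Pi.single y 1 : X → 𝕜) ∈ T := by
      intro y
      have hle : Submodule.span ℝ
          (Set.range fun p : (Σ i, J i) × G => fun x => u p.1.1 (p.2 • x) p.1.2) ≤
          (T.restrictScalars ℝ).comap
            (LinearMap.compLeft (RCLike.ofRealAm (K := 𝕜)).toLinearMap X) := by
        rw [Submodule.span_le]
        rintro _ ⟨⟨⟨i, j⟩, g⟩, rfl⟩
        have h1 : v i j ∈ T ∧ ρ g⁻¹ (v i j) ∈ T := by
          have hi : (orbitSpan ρ (v i j)).toSubmodule ≤ T :=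
            le_iSup_of_le i (le_iSup (fun j => (orbitSpan ρ (v i j)).toSubmodule) j)
          exact ⟨hi (self_mem_orbitSpan _ _), hi (apply_mem_orbitSpan _ _ _)⟩
        have h2 : (fun x => ((u i (g • x) j : ℝ) : 𝕜)) = ρ g⁻¹ (v i j) := by
          ext x
          simp [hρ, permRep_apply, v, castVec]
        change (fun x => ((u i (g • x) j : ℝ) : 𝕜)) ∈ T
        rw [h2]
        exact h1.2
      have h2 := hle (hspan y)
      have h3 : (Pi.single y 1 : X → 𝕜) = fun x => (((Pi.single y 1 : X → ℝ) x : ℝ) : 𝕜) := by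
        ext x
        by_cases h : x = y <;> simp [h]
      rw [h3]
      exact h2
    rw [← Finset.univ_sum_single f]
    refine Submodule.sum_mem _ fun y _ => ?_
    have := T.smul_mem (f y) (hsingle y)
    rwa [← Pi.single_smul', smul_eq_mul, mul_one] at this
  · intro i j i' j'
    constructor
    · rintro ⟨e⟩
      by_contra hi
      obtain ⟨w, hw, hew⟩ := groupAlgebra_apply_equiv (kernelOp_mem_span (𝕜 := 𝕜) (hker i)) e
        ⟨v i j, self_mem_orbitSpan ρ _⟩
      rw [hop_other i i' j' hi _ (e.toLinearEquiv _).2] at hew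
      have hw0 : w = 0 := e.toLinearEquiv.map_eq_zero_iff.1 (Subtype.ext hew)
      rw [hw0, hop_self i j _ (self_mem_orbitSpan ρ _)] at hw
      refine smul_ne_zero (mul_ne_zero (hc' i j) ?_) (hv i j) hw.symm
      exact fun h => hv i j (dotProduct_star_self_eq_zero.1 h)
    · rintro rfl
      exact ⟨(hiso' i j j').choose⟩
  · exact fun i j => self_mem_orbitSpan ρ _
  · exact hv
  · exact hiso'

end Kernel

/-! ### Kernel families -/

/-- Vectors `u i` in `ℝ^X` whose submodules, under the action `act` of `H` on `X`, are pairwise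
orthogonal and generate `ℝ^X`, and for which the rank one operators `u i (u i)ᵀ` lie in the group
algebra of `H`. -/
structure IsKernelFamily {H X ι : Type*} [Fintype X] (act : H → X → X) (u : ι → X → ℝ) :
    Prop where
  ne_zero : ∀ i, u i ≠ 0
  orthogonal : ∀ i i', i ≠ i' → ∀ h, ∑ x, u i x * u i' (act h x) = 0
  kernel : ∀ i, IsGroupKernel act fun x y => u i x * u i y
  span : ∀ y, (by classical exact Pi.single y (1 : ℝ)) ∈
    Submodule.span ℝ (Set.range fun p : ι × H => fun x => u p.1 (act p.2 x))

/-- The definition of a kernel family depends only on the set of permutations that act. -/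
theorem IsKernelFamily.congr {H H' X ι ι' : Type*} [Fintype X] {act : H → X → X}
    {act' : H' → X → X} {u : ι → X → ℝ} (hu : IsKernelFamily act u)
    (h₁ : ∀ h, ∃ h', act' h' = act h) (h₂ : ∀ h', ∃ h, act h = act' h') (e : ι' ≃ ι) :
    IsKernelFamily act' fun i => u (e i) where
  ne_zero i := hu.ne_zero _
  orthogonal i i' hi h' := by
    obtain ⟨h, hh⟩ := h₂ h'
    rw [← hh]
    exact hu.orthogonal _ _ (e.injective.ne hi) h
  kernel i := by
    obtain ⟨κ, _, g, a, hk⟩ := hu.kernel (e i)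
    choose φ hφ using h₁
    exact ⟨κ, _, fun s => φ (g s), a, fun x y =>
      (hk x y).trans (Finset.sum_congr rfl fun s _ => by rw [hφ])⟩
  span y := by
    refine Submodule.span_mono ?_ (hu.span y)
    rintro _ ⟨⟨i, h⟩, rfl⟩
    obtain ⟨h', hh⟩ := h₁ h
    exact ⟨⟨e.symm i, h'⟩, by simp [hh]⟩

/-- The outer tensor products of two kernel families form a kernel family. -/
theorem IsKernelFamily.prod {H H' X X' ι ι' : Type*} [Fintype X] [Fintype X']
    {act : H → X → X} {act' : H' → X' → X'} {u : ι → X → ℝ} {u' : ι' → X' → ℝ}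
    (hu : IsKernelFamily act u) (hu' : IsKernelFamily act' u') :
    IsKernelFamily (fun (h : H × H') (x : X × X') => (act h.1 x.1, act' h.2 x.2))
      fun (i : ι × ι') x => u i.1 x.1 * u' i.2 x.2 where
  ne_zero i := by
    obtain ⟨x, hx⟩ := Function.ne_iff.1 (hu.ne_zero i.1)
    obtain ⟨x', hx'⟩ := Function.ne_iff.1 (hu'.ne_zero i.2)
    exact Function.ne_iff.2 ⟨(x, x'), mul_ne_zero hx hx'⟩
  orthogonal i i' hi h := by
    have key : ∑ x : X × X', u i.1 x.1 * u' i.2 x.2 *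
        (u i'.1 (act h.1 x.1) * u' i'.2 (act' h.2 x.2)) =
        (∑ x, u i.1 x * u i'.1 (act h.1 x)) * ∑ x, u' i.2 x * u' i'.2 (act' h.2 x) := by
      rw [Finset.sum_mul_sum, Fintype.sum_prod_type]
      refine Finset.sum_congr rfl fun x _ => Finset.sum_congr rfl fun y _ => ?_
      ring
    rw [key]
    by_cases h1 : i.1 = i'.1
    · rw [hu'.orthogonal i.2 i'.2 (fun h2 => hi (Prod.ext h1 h2)), mul_zero]
    · rw [hu.orthogonal i.1 i'.1 h1, zero_mul]
  kernel i := by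
    classical
    obtain ⟨κ, _, g, a, hk⟩ := hu.kernel i.1
    obtain ⟨κ', _, g', a', hk'⟩ := hu'.kernel i.2
    refine ⟨κ × κ', inferInstance, fun s => (g s.1, g' s.2), fun s => a s.1 * a' s.2,
      fun x y => ?_⟩
    have h1 := hk x.1 y.1
    have h2 := hk' x.2 y.2
    beta_reduce at h1 h2 ⊢
    rw [mul_mul_mul_comm, h1, h2, Finset.sum_mul_sum, Fintype.sum_prod_type]
    refine Finset.sum_congr rfl fun s _ => Finset.sum_congr rfl fun s' _ => ?_
    simp only [Prod.ext_iff]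
    split_ifs <;> simp_all
  span y := by
    classical
    have key : ∀ f ∈ Submodule.span ℝ (Set.range fun p : ι × H => fun x => u p.1 (act p.2 x)),
        ∀ f' ∈ Submodule.span ℝ (Set.range fun p : ι' × H' => fun x => u' p.1 (act' p.2 x)),
        (fun x : X × X' => f x.1 * f' x.2) ∈ Submodule.span ℝ
          (Set.range fun p : (ι × ι') × H × H' => fun x : X × X' =>
            u p.1.1 (act p.2.1 x.1) * u' p.1.2 (act' p.2.2 x.2)) := by
      intro f hf f' hf'
      let m : (X → ℝ) →ₗ[ℝ] (X' → ℝ) →ₗ[ℝ] X × X' → ℝ :=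
        LinearMap.mk₂ ℝ (fun f f' x => f x.1 * f' x.2)
          (fun _ _ _ => funext fun _ => add_mul _ _ _)
          (fun _ _ _ => funext fun _ => mul_assoc _ _ _)
          (fun _ _ _ => funext fun _ => mul_add _ _ _)
          (fun _ _ _ => funext fun _ => mul_left_comm _ _ _)
      have h := Submodule.apply_mem_map₂ m hf hf'
      rw [Submodule.map₂_span_span] at h
      refine Submodule.span_mono ?_ h
      rintro _ ⟨_, ⟨p, rfl⟩, _, ⟨p', rfl⟩, rfl⟩
      exact ⟨⟨⟨p.1, p'.1⟩, p.2, p'.2⟩, rfl⟩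
    convert key _ (hu.span y.1) _ (hu'.span y.2) using 1
    ext x
    simp only [Pi.single_apply, Prod.ext_iff]
    split_ifs <;> simp_all

/-! ### Words over one alphabet -/

section Words

variable {q : ℕ} (a b : Fin q)

/-- The all-ones vector of `ℝ^q` if `t` is true, and `e_a - e_b` otherwise. -/
def letterVec (t : Bool) : Fin q → ℝ := fun x =>
  if t then 1 else (if x = a then 1 else 0) - (if x = b then 1 else 0)

/-- The tensor product of `l` all-ones vectors and `n - l` vectors `e_a - e_b`. -/
def wordVec (n l : ℕ) : (Fin n → Fin q) → ℝ := fun x =>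
  ∏ i : Fin n, letterVec a b (decide ((i : ℕ) < l)) (x i)

variable {a b}

/-- The constants of `ℝ^q` are orthogonal to every translate of `e_a - e_b`. -/
theorem sum_letterVec_mul_letterVec {t t' : Bool} (ht : t ≠ t')
    (σ : Equiv.Perm (Fin q)) : ∑ x, letterVec a b t x * letterVec a b t' (σ x) = 0 := by
  have h : ∀ σ : Equiv.Perm (Fin q), ∑ x, letterVec a b false (σ x) = 0 := by
    intro σ
    rw [Equiv.sum_comp σ]
    simp [letterVec]
  cases t <;> cases t'
  · exact absurd rfl ht
  · simp [letterVec]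
  · simpa [letterVec] using h σ
  · exact absurd rfl ht

/-- The operators `1 - (a b)` and `∑ s, (x ↦ s + x)` on `ℝ^q` have rank one. -/
theorem exists_letter_kernel (hab : a ≠ b) (t : Bool) : ∃ α : Equiv.Perm (Fin q) → ℝ, ∀ x y,
    letterVec a b t x * letterVec a b t y = ∑ σ, if σ y = x then α σ else 0 := by
  have : NeZero q := ⟨fun h => (h ▸ a : Fin 0).elim0⟩
  cases t
  · refine ⟨fun σ => (if σ = 1 then 1 else 0) - (if σ = Equiv.swap a b then 1 else 0),
      fun x y => ?_⟩
    have : ∀ σ : Equiv.Perm (Fin q), (if σ y = x then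
        ((if σ = 1 then 1 else 0) - (if σ = Equiv.swap a b then 1 else 0) : ℝ) else 0) =
        (if σ = 1 then (if σ y = x then 1 else 0) else 0) -
        (if σ = Equiv.swap a b then (if σ y = x then 1 else 0) else 0) := by
      intro σ; split_ifs <;> simp
    simp only [this, Finset.sum_sub_distrib, Finset.sum_ite_eq', Finset.mem_univ, if_true,
      Equiv.Perm.one_apply, Equiv.swap_apply_def, letterVec]
    grind
  · refine ⟨fun σ => ∑ c : Fin q, if σ = Equiv.addLeft c then 1 else 0, fun x y => ?_⟩
    have : ∀ σ : Equiv.Perm (Fin q), (if σ y = x then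
        (∑ c : Fin q, if σ = Equiv.addLeft c then (1 : ℝ) else 0) else 0) =
        ∑ c : Fin q, if σ = Equiv.addLeft c then (if σ y = x then 1 else 0) else 0 := by
      intro σ
      split_ifs <;> simp
    simp only [this]
    rw [Finset.sum_comm]
    simp only [Finset.sum_ite_eq', Finset.mem_univ, if_true, Equiv.coe_addLeft,
      ← eq_sub_iff_add_eq]
    simp [letterVec]

theorem exists_perm_letters {c d : Fin q} (hab : a ≠ b) (hcd : c ≠ d) :
    ∃ σ : Equiv.Perm (Fin q), σ c = a ∧ σ d = b := by
  refine ⟨Equiv.swap (Equiv.swap c a d) b * Equiv.swap c a, ?_, ?_⟩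
  · rw [Equiv.Perm.mul_apply, Equiv.swap_apply_left]
    refine Equiv.swap_apply_of_ne_of_ne (fun h => hcd ?_) hab
    rw [← (Equiv.swap c a).injective.eq_iff, ← h, Equiv.swap_apply_left]
  · rw [Equiv.Perm.mul_apply, Equiv.swap_apply_left]

theorem wreathPerm_apply {n : ℕ} (h : Wreath q n) (x : Fin n → Fin q) (i : Fin n) :
    wreathPerm q n h x i = h.left i (x (h.right⁻¹ i)) := rfl

theorem wordVec_wreathPerm (n l : ℕ) (h : Wreath q n) (x : Fin n → Fin q) :
    wordVec a b n l (wreathPerm q n h x) =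
      ∏ i, letterVec a b (decide ((h.right i : ℕ) < l)) (h.left (h.right i) (x i)) := by
  simp only [wordVec, wreathPerm_apply]
  rw [← Equiv.prod_comp h.right]
  simp

theorem wordVec_ne_zero (hab : a ≠ b) (n l : ℕ) : wordVec a b n l ≠ 0 := by
  refine Function.ne_iff.2 ⟨fun _ => a, Finset.prod_ne_zero_iff.2 fun i _ => ?_⟩
  unfold letterVec
  split_ifs <;> simp_all

theorem sum_wordVec_mul_wordVec {n l l' : ℕ} (hl : l ≤ n) (hl' : l' ≤ n)
    (hne : l ≠ l') (h : Wreath q n) :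
    ∑ x, wordVec a b n l x * wordVec a b n l' (wreathPerm q n h x) = 0 := by
  simp only [wordVec_wreathPerm]
  simp only [wordVec, ← Finset.prod_mul_distrib]
  rw [← Fintype.prod_sum fun (i : Fin n) (c : Fin q) => letterVec a b (decide ((i : ℕ) < l)) c *
    letterVec a b (decide ((h.right i : ℕ) < l')) (h.left (h.right i) c)]
  -- By counting, some coordinate is matched with one of the other kind.
  obtain ⟨i, hi⟩ : ∃ i : Fin n, decide ((i : ℕ) < l) ≠ decide ((h.right i : ℕ) < l') := by
    by_contra! hall
    apply hne
    have h1 := Fin.card_filter_val_lt (n := n) (m := l)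
    have h2 := Fin.card_filter_val_lt (n := n) (m := l')
    have h3 : (Finset.univ.filter fun i : Fin n => (i : ℕ) < l).map h.right.toEmbedding =
        Finset.univ.filter fun i : Fin n => (i : ℕ) < l' := by
      ext j
      have := hall (h.right⁻¹ j)
      simp only [decide_eq_decide, ← Equiv.Perm.mul_apply, mul_inv_cancel, Equiv.Perm.one_apply]
        at this
      simp only [Finset.mem_map_equiv, Finset.mem_filter, Finset.mem_univ, true_and]
      exact this
    rw [← Finset.card_map h.right.toEmbedding, h3] at h1
    omega
  exact Finset.prod_eq_zero (Finset.mem_univ i) (sum_letterVec_mul_letterVec hi _)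

/-- The rank one operator of a tensor product is the tensor product of those of its factors;
expanding it gives a linear combination of letter permutations. -/
theorem wordVec_kernel (hab : a ≠ b) (n l : ℕ) :
    IsGroupKernel (fun (h : Wreath q n) x => wreathPerm q n h x)
      fun x y => wordVec a b n l x * wordVec a b n l y := by
  choose α hα using fun t => exists_letter_kernel hab t
  refine ⟨Fin n → Equiv.Perm (Fin q), inferInstance, fun σ => ⟨σ, 1⟩,
    fun σ => ∏ i : Fin n, α (decide ((i : ℕ) < l)) (σ i), fun x y => ?_⟩
  classical
  simp only [wordVec, ← Finset.prod_mul_distrib, hα]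
  rw [Fintype.prod_sum]
  refine Finset.sum_congr rfl fun σ _ => ?_
  rw [Finset.prod_ite_zero]
  simp [funext_iff, wreathPerm_apply]

/-- Up to the factor `q^n`, the unit vector of a word is a sum of tensor products of vectors `1`
and `e_c - e_d`. -/
theorem single_eq_sum_prod {n : ℕ} (hq : (q : ℝ) ≠ 0) (x y : Fin n → Fin q) :
    (if x = y then 1 else 0 : ℝ) = ((q : ℝ)⁻¹) ^ n * ∑ β : Fin n → Fin q,
      ∏ i, letterVec (y i) (β i) (decide (β i = y i)) (x i) := by
  rw [← Fintype.prod_sum fun (i : Fin n) (c : Fin q) =>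
    letterVec (y i) c (decide (c = y i)) (x i)]
  have : ∀ i, ∑ c, letterVec (y i) c (decide (c = y i)) (x i) = q * if x i = y i then 1 else 0 := by
    intro i
    have h : ∀ c, letterVec (y i) c (decide (c = y i)) (x i) =
        (if x i = y i then 1 else 0) + ((if c = y i then 1 else 0) - if c = x i then 1 else 0) := by
      intro c
      simp only [letterVec, decide_eq_true_eq]
      grind
    simp only [h, Finset.sum_add_distrib, Finset.sum_sub_distrib]
    simp
  simp only [this, Finset.prod_mul_distrib]
  rw [Finset.prod_const, Finset.card_univ, Fintype.card_fin, ← mul_assoc, ← mul_pow,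
    inv_mul_cancel₀ hq, one_pow, one_mul, Finset.prod_ite_zero]
  simp [funext_iff]

/-- Every tensor product of vectors `1` and `e_c - e_d` is a translate of a vector `wordVec`. -/
theorem exists_wordVec_translate {n : ℕ} (hab : a ≠ b) (y β : Fin n → Fin q) :
    ∃ (l : Fin (n + 1)) (h : Wreath q n), ∀ x, wordVec a b n l (wreathPerm q n h x) =
      ∏ i, letterVec (y i) (β i) (decide (β i = y i)) (x i) := by
  set S := Finset.univ.filter fun i => β i = y i with hS
  have hle : S.card ≤ n := by simpa using S.card_le_univ
  have hcard : Fintype.card {i // β i = y i} = Fintype.card {i : Fin n // (i : ℕ) < S.card} := by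
    rw [Fintype.card_subtype, Fintype.card_subtype, Fin.card_filter_val_lt]
    rw [min_eq_right hle]
  let e := Fintype.equivOfCardEq hcard
  have he : ∀ i, (e.extendSubtype i : ℕ) < S.card ↔ β i = y i := fun i =>
    ⟨fun h => by_contra fun hn => e.extendSubtype_not_mem i hn h, fun h => e.extendSubtype_mem i h⟩
  have hσ : ∀ i, ∃ σ : Equiv.Perm (Fin q), β i ≠ y i → σ (y i) = a ∧ σ (β i) = b := by
    intro i
    by_cases h : β i = y i
    · exact ⟨1, fun h' => absurd h h'⟩
    · obtain ⟨σ, hσ⟩ := exists_perm_letters hab (Ne.symm h)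
      exact ⟨σ, fun _ => hσ⟩
  choose σ hσ using hσ
  refine ⟨⟨S.card, by omega⟩, ⟨fun i => σ (e.extendSubtype⁻¹ i), e.extendSubtype⟩, fun x => ?_⟩
  rw [wordVec_wreathPerm]
  refine Finset.prod_congr rfl fun i _ => ?_
  have hi : e.extendSubtype⁻¹ (e.extendSubtype i) = i := by simp
  simp only [he, hi]
  by_cases h : β i = y i
  · simp [h, letterVec]
  · obtain ⟨h1, h2⟩ := hσ i h
    simp only [h, letterVec, decide_false, Bool.false_eq_true, if_false,
      ← (σ i).injective.eq_iff (b := y i), ← (σ i).injective.eq_iff (b := β i), h1, h2]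

theorem isKernelFamily_wordVec (hab : a ≠ b) (n : ℕ) :
    IsKernelFamily (fun (h : Wreath q n) x => wreathPerm q n h x)
      fun l : Fin (n + 1) => wordVec a b n l where
  ne_zero l := wordVec_ne_zero hab n l
  orthogonal l l' hl h := sum_wordVec_mul_wordVec (by omega) (by omega)
    (fun h => hl (Fin.ext h)) h
  kernel l := wordVec_kernel hab n l
  span y := by
    have hq : (q : ℝ) ≠ 0 := by
      rintro h
      obtain rfl : q = 0 := by exact_mod_cast h
      exact a.elim0
    have : (Pi.single y 1 : (Fin n → Fin q) → ℝ) = ((q : ℝ)⁻¹) ^ n • ∑ β : Fin n → Fin q,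
        fun x => ∏ i, letterVec (y i) (β i) (decide (β i = y i)) (x i) := by
      ext x
      rw [Pi.single_apply, single_eq_sum_prod hq x y]
      simp
    have hmem : (Pi.single y 1 : (Fin n → Fin q) → ℝ) ∈ Submodule.span ℝ (Set.range
        fun p : Fin (n + 1) × Wreath q n => fun x => wordVec a b n p.1 (wreathPerm q n p.2 x)) := by
      rw [this]
      refine Submodule.smul_mem _ _ (Submodule.sum_mem _ fun β _ => ?_)
      obtain ⟨l, h, hl⟩ := exists_wordVec_translate hab y β
      exact Submodule.subset_span ⟨⟨l, h⟩, funext hl⟩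
    convert hmem

end Words

/-! ### Isometries of mixed words -/

theorem hammingDist_wreathPerm {q n : ℕ} (h : Wreath q n) (x y : Fin n → Fin q) :
    hammingDist (wreathPerm q n h x) (wreathPerm q n h y) = hammingDist x y := by
  unfold hammingDist
  rw [← Finset.card_map (s := Finset.univ.filter fun i => x i ≠ y i) h.right.toEmbedding]
  congr 1
  ext i
  simp [wreathPerm_apply, Finset.mem_map_equiv]

theorem mixedPerm_apply {n₂ n₃ : ℕ} (h : Wreath 2 n₂ × Wreath 3 n₃) (v : Word n₂ n₃) :
    mixedPerm n₂ n₃ h v = (wreathPerm 2 n₂ h.1 v.1, wreathPerm 3 n₃ h.2 v.2) := rfl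

theorem mixedPerm_mem_isometryGroup {n₂ n₃ : ℕ} (h : Wreath 2 n₂ × Wreath 3 n₃) :
    mixedPerm n₂ n₃ h ∈ isometryGroup n₂ n₃ := fun v w => by
  simp only [mixedPerm_apply, wordDist, hammingDist_wreathPerm]

theorem wreathPerm_injective {q n : ℕ} {a b : Fin q} (hab : a ≠ b) :
    Function.Injective (wreathPerm q n) := by
  refine (injective_iff_map_eq_one _).2 fun h hh => ?_
  have hx : ∀ (x : Fin n → Fin q) i, h.left i (x (h.right⁻¹ i)) = x i := fun x i => by
    rw [← wreathPerm_apply, hh]; rfl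
  have hl : h.left = 1 := funext fun i => Equiv.ext fun c => hx (fun _ => c) i
  refine SemidirectProduct.ext hl (inv_injective (Equiv.ext fun i => ?_))
  by_contra hi
  change ¬h.right⁻¹ i = i at hi
  have h1 := hx (fun j => if j = i then a else b) i
  rw [hl, if_pos rfl, if_neg hi] at h1
  exact hab h1.symm

theorem mixedPerm_injective (n₂ n₃ : ℕ) : Function.Injective (mixedPerm n₂ n₃) := by
  intro h h' hh
  have hv : ∀ v, mixedPerm n₂ n₃ h v = mixedPerm n₂ n₃ h' v := fun v => by rw [hh]
  refine Prod.ext (wreathPerm_injective (a := 0) (b := 1) (by decide) ?_)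
    (wreathPerm_injective (a := 0) (b := 1) (by decide) ?_)
  · exact Equiv.ext fun x => congrArg Prod.fst (hv (x, 0))
  · exact Equiv.ext fun x => congrArg Prod.snd (hv (0, x))

section Atoms

variable {q n : ℕ} [NeZero q]

/-- A word has the nonzero letter `c` in coordinate `i` exactly if it is closer to the word with
this single nonzero letter than to the zero word. -/
theorem hammingDist_single_lt_iff (x : Fin n → Fin q) (i : Fin n) {c : Fin q} (hc : c ≠ 0) :
    hammingDist x (Pi.single i c) < hammingDist x 0 ↔ x i = c := by
  constructor
  · intro h
    by_contra hi
    refine h.not_ge (Finset.card_le_card fun j hj => ?_)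
    simp only [Finset.mem_filter, Finset.mem_univ, true_and, Pi.zero_apply] at hj ⊢
    by_cases hji : j = i
    · subst hji; simpa using hi
    · simpa [Pi.single_eq_of_ne hji] using hj
  · rintro rfl
    refine Finset.card_lt_card
      (Finset.ssubset_iff_of_subset ?_ |>.2 ⟨i, by simpa using hc, by simp⟩)
    intro j hj
    simp only [Finset.mem_filter, Finset.mem_univ, true_and, Pi.zero_apply] at hj ⊢
    by_cases hji : j = i
    · subst hji; simp at hj
    · simpa [Pi.single_eq_of_ne hji] using hj

theorem exists_single_of_hammingDist_zero {x : Fin n → Fin q} (hx : hammingDist x 0 = 1) :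
    ∃ i c, c ≠ 0 ∧ x = Pi.single i c := by
  obtain ⟨i, hi⟩ := Finset.card_eq_one.1 hx
  have h : ∀ j, x j ≠ 0 ↔ j = i := fun j => by simpa using Finset.ext_iff.1 hi j
  refine ⟨i, x i, (h i).2 rfl, funext fun j => ?_⟩
  by_cases hj : j = i
  · subst hj; simp
  · rw [Pi.single_eq_of_ne hj]
    exact not_not.1 fun h0 => hj ((h j).1 h0)

theorem hammingDist_single_single {i j : Fin n} (hij : i ≠ j) {c d : Fin q} (hc : c ≠ 0)
    (hd : d ≠ 0) : 1 < hammingDist (Pi.single i c : Fin n → Fin q) (Pi.single j d) :=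
  Finset.one_lt_card.2 ⟨i, by simpa [Pi.single_eq_of_ne hij] using hc, j,
    by simpa [Pi.single_eq_of_ne hij.symm] using hd.symm, hij⟩

theorem hammingDist_single_same (i : Fin n) {c d : Fin q} (hcd : c ≠ d) :
    hammingDist (Pi.single i c : Fin n → Fin q) (Pi.single i d) = 1 := by
  refine Finset.card_eq_one.2 ⟨i, Finset.ext fun j => ?_⟩
  by_cases hj : j = i
  · subst hj; simpa using hcd
  · simp [hj]

theorem hammingDist_single_zero (i : Fin n) {c : Fin q} (hc : c ≠ 0) :
    hammingDist (Pi.single i c : Fin n → Fin q) 0 = 1 := by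
  simpa using hammingDist_single_same i hc

theorem wreathPerm_single (h : Wreath q n) (i : Fin n) (c : Fin q) (h0 : ∀ j, h.left j 0 = 0) :
    wreathPerm q n h (Pi.single i c) = Pi.single (h.right i) (h.left (h.right i) c) := by
  ext j : 1
  rw [wreathPerm_apply]
  by_cases hj : j = h.right i
  · subst hj; simp
  · rw [Pi.single_eq_of_ne hj, Pi.single_eq_of_ne, h0]
    rintro rfl
    simp at hj

theorem wreathPerm_zero (h : Wreath q n) (h0 : ∀ j, h.left j 0 = 0) : wreathPerm q n h 0 = 0 :=
  funext h0

end Atoms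

section Isometries

variable {n₂ n₃ : ℕ}

/-- The words at distance one from the zero word, here called atoms, have a single nonzero
letter. -/
theorem eq_atom_of_wordDist_zero {v : Word n₂ n₃} (hv : wordDist v 0 = 1) :
    (∃ i, v = (Pi.single i 1, 0)) ∨ ∃ i c, c ≠ 0 ∧ v = (0, Pi.single i c) := by
  have h : hammingDist v.1 0 + hammingDist v.2 0 = 1 := hv
  rcases Nat.eq_zero_or_pos (hammingDist v.1 0) with h1 | h1
  · obtain ⟨i, c, hc, hx⟩ := exists_single_of_hammingDist_zero (x := v.2) (by omega)
    exact .inr ⟨i, c, hc, Prod.ext (hammingDist_eq_zero.1 h1) hx⟩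
  · obtain ⟨i, c, hc, hx⟩ := exists_single_of_hammingDist_zero (x := v.1) (by omega)
    have hc1 : c = 1 := by omega
    exact .inl ⟨i, Prod.ext (hc1 ▸ hx) (hammingDist_eq_zero.1 (by omega : hammingDist v.2 0 = 0))⟩

theorem wordDist_fst_atom_zero (i : Fin n₂) :
    wordDist ((Pi.single i 1, 0) : Word n₂ n₃) 0 = 1 := by
  have := hammingDist_single_zero i (c := (1 : Fin 2)) (by decide)
  simp only [wordDist, Prod.fst_zero, Prod.snd_zero, hammingDist_self, this]

theorem wordDist_snd_atom_zero (i : Fin n₃) {c : Fin 3} (hc : c ≠ 0) :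
    wordDist ((0, Pi.single i c) : Word n₂ n₃) 0 = 1 := by
  have := hammingDist_single_zero i hc
  simp only [wordDist, Prod.fst_zero, Prod.snd_zero, hammingDist_self, this]

/-- An isometry is determined by its values at the zero word and at the words at distance one
from it. -/
theorem eq_one_of_fix_atoms {g : Equiv.Perm (Word n₂ n₃)} (hg : g ∈ isometryGroup n₂ n₃)
    (h0 : g 0 = 0) (h2 : ∀ i, g (Pi.single i 1, 0) = (Pi.single i 1, 0))
    (h3 : ∀ i c, c ≠ 0 → g (0, Pi.single i c) = (0, Pi.single i c)) : g = 1 := by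
  have letters : ∀ {q : ℕ} [NeZero q] {a b : Fin q}, (∀ c, c ≠ 0 → (a = c ↔ b = c)) → a = b := by
    intro q _ a b h
    by_cases ha : a = 0
    · by_contra hab
      exact hab ((h b (fun hb => hab (ha.trans hb.symm))).2 rfl)
    · exact ((h a ha).1 rfl).symm
  refine Equiv.ext fun x => Prod.ext (funext fun i => letters fun c hc => ?_)
    (funext fun i => letters fun c hc => ?_)
  · obtain rfl : c = 1 := by omega
    have e1 := hg x (Pi.single i 1, 0)
    have e0 := hg x 0
    rw [h2] at e1
    rw [h0] at e0
    rw [← hammingDist_single_lt_iff _ _ hc, ← hammingDist_single_lt_iff _ _ hc]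
    simp only [wordDist, Prod.fst_zero, Prod.snd_zero] at e0 e1
    simp only [Equiv.Perm.one_apply]
    omega
  · have e1 := hg x (0, Pi.single i c)
    have e0 := hg x 0
    rw [h3 i c hc] at e1
    rw [h0] at e0
    rw [← hammingDist_single_lt_iff _ _ hc, ← hammingDist_single_lt_iff _ _ hc]
    simp only [wordDist, Prod.fst_zero, Prod.snd_zero] at e0 e1
    simp only [Equiv.Perm.one_apply]
    omega

/-- An isometry that fixes the zero word preserves the binary atoms: they are the words at distance
one from the zero word that do not form a triangle with it and a third word. -/
theorem exists_map_fst_atom {g : Equiv.Perm (Word n₂ n₃)} (hg : g ∈ isometryGroup n₂ n₃)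
    (h0 : g 0 = 0) (i : Fin n₂) : ∃ j, g (Pi.single i 1, 0) = (Pi.single j 1, 0) := by
  have hd : wordDist (g (Pi.single i 1, 0)) 0 = 1 := by
    have h := hg (Pi.single i 1, 0) 0
    rwa [h0, wordDist_fst_atom_zero] at h
  rcases eq_atom_of_wordDist_zero hd with h | ⟨k, c, hc, h⟩
  · exact h
  · obtain ⟨d, hd0, hdc⟩ : ∃ d : Fin 3, d ≠ 0 ∧ d ≠ c :=
      (by decide : ∀ c : Fin 3, ∃ d : Fin 3, d ≠ 0 ∧ d ≠ c) c
    obtain ⟨w, hw⟩ := g.surjective (0, Pi.single k d)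
    have hw0 : wordDist w 0 = 1 := by
      rw [← hg, h0, hw, wordDist_snd_atom_zero k hd0]
    have hwi : wordDist w (Pi.single i 1, 0) = 1 := by
      rw [← hg, h, hw]
      simp only [wordDist, hammingDist_self, hammingDist_single_same k hdc]
    rcases eq_atom_of_wordDist_zero hw0 with ⟨j, rfl⟩ | ⟨j, e, he, rfl⟩
    · simp only [wordDist, hammingDist_self, add_zero] at hwi
      by_cases hj : j = i
      · subst hj; simp at hwi
      · have := hammingDist_single_single hj (c := (1 : Fin 2)) (d := 1) (by decide) (by decide)
        omega
    · have h1 := hammingDist_single_zero i (c := (1 : Fin 2)) (by decide)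
      rw [hammingDist_comm] at h1
      simp only [wordDist, h1, hammingDist_single_zero j he] at hwi
      omega

/-- As `g⁻¹` preserves the binary atoms, `g` preserves the ternary ones. -/
theorem exists_map_snd_atom {g : Equiv.Perm (Word n₂ n₃)} (hg : g ∈ isometryGroup n₂ n₃)
    (h0 : g 0 = 0) (i : Fin n₃) {c : Fin 3} (hc : c ≠ 0) :
    ∃ j d, d ≠ 0 ∧ g (0, Pi.single i c) = (0, Pi.single j d) := by
  have hd : wordDist (g (0, Pi.single i c)) 0 = 1 := by
    have h := hg (0, Pi.single i c) 0
    rwa [h0, wordDist_snd_atom_zero i hc] at h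
  rcases eq_atom_of_wordDist_zero hd with ⟨k, h⟩ | h
  · obtain ⟨j, hj⟩ := exists_map_fst_atom (inv_mem hg) (Equiv.Perm.inv_eq_iff_eq.2 h0.symm) k
    rw [← h, ← Equiv.Perm.mul_apply, inv_mul_cancel, Equiv.Perm.one_apply] at hj
    have := congrFun (congrArg Prod.fst hj) j
    simp at this
  · exact h

theorem mem_range_of_fix_zero {g : Equiv.Perm (Word n₂ n₃)} (hg : g ∈ isometryGroup n₂ n₃)
    (h0 : g 0 = 0) : g ∈ (mixedPerm n₂ n₃).range := by
  choose p hp using exists_map_fst_atom hg h0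
  choose r d hd hr using fun i => exists_map_snd_atom hg h0 i (c := 1) (by decide)
  choose r' d' hd' hr' using fun i => exists_map_snd_atom hg h0 i (c := 2) (by decide)
  -- The words with letter `1` or `2` in coordinate `i` are at distance one, so their images share
  -- a coordinate.
  have hrr : ∀ i, r' i = r i := by
    intro i
    by_contra hne
    have h1 := hg (0, Pi.single i 2) (0, Pi.single i 1)
    rw [hr, hr'] at h1
    simp only [wordDist, hammingDist_self,
      hammingDist_single_same i (show (2 : Fin 3) ≠ 1 by decide)] at h1
    have := hammingDist_single_single hne (hd' i) (hd i)
    omega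
  have hdd : ∀ i, d i ≠ d' i := by
    intro i h
    have h1 : g (0, Pi.single i 1) = g (0, Pi.single i 2) := by rw [hr, hr', h, hrr]
    have h2 := congrFun (congrArg Prod.snd (g.injective h1)) i
    simp at h2
  have hp_inj : Function.Injective p := by
    intro i j hij
    have h1 : g (Pi.single i 1, 0) = g (Pi.single j 1, 0) := by rw [hp, hp, hij]
    have h2 := congrFun (congrArg Prod.fst (g.injective h1)) i
    by_contra hne
    simp [Pi.single_eq_of_ne hne] at h2
  have hr_inj : Function.Injective r := by
    intro i j hij
    by_contra hne
    have h1 := hg (0, Pi.single i 1) (0, Pi.single j 1)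
    rw [hr, hr, hij] at h1
    have h2 := hammingDist_single_single hne (c := (1 : Fin 3)) (d := 1) (by decide) (by decide)
    simp only [wordDist, hammingDist_self] at h1
    by_cases hdij : d i = d j
    · rw [hdij, hammingDist_self] at h1; omega
    · rw [hammingDist_single_same _ hdij] at h1; omega
  have hs : ∀ c c' : Fin 3, c ≠ 0 → c' ≠ 0 → c ≠ c' →
      ∃ σ : Equiv.Perm (Fin 3), σ 0 = 0 ∧ σ 1 = c ∧ σ 2 = c' := by decide
  choose s hs0 hs1 hs2 using fun i => hs (d i) (d' i) (hd i) (hd' i) (hdd i)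
  let P := Equiv.ofBijective p (Finite.injective_iff_bijective.1 hp_inj)
  let R := Equiv.ofBijective r (Finite.injective_iff_bijective.1 hr_inj)
  -- The letters `s i` are applied after the coordinates have been permuted.
  let h : Wreath 2 n₂ × Wreath 3 n₃ := (⟨1, P⟩, ⟨fun j => s (R⁻¹ j), R⟩)
  have hR : ∀ i, R⁻¹ (R i) = i := fun i => by simp
  have h3 : ∀ i c, mixedPerm n₂ n₃ h (0, Pi.single i c) = (0, Pi.single (r i) (s i c)) := by
    intro i c
    refine Prod.ext (wreathPerm_zero _ fun _ => rfl) ?_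
    have := wreathPerm_single h.2 i c fun j => hs0 (R⁻¹ j)
    change wreathPerm 3 n₃ h.2 (Pi.single i c) = _
    rw [this]
    change (Pi.single (r i) (s (R⁻¹ (R i)) c) : Fin n₃ → Fin 3) = _
    rw [hR]
  refine ⟨h, (inv_mul_eq_one.1 (eq_one_of_fix_atoms (g := g⁻¹ * mixedPerm n₂ n₃ h)
    (mul_mem (inv_mem hg) (mixedPerm_mem_isometryGroup h)) ?_ (fun i => ?_)
    fun i c hc => ?_)).symm⟩
  · rw [Equiv.Perm.mul_apply, Equiv.Perm.inv_eq_iff_eq, h0]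
    exact Prod.ext (wreathPerm_zero _ fun _ => rfl) (wreathPerm_zero _ fun j => hs0 (R⁻¹ j))
  · rw [Equiv.Perm.mul_apply, Equiv.Perm.inv_eq_iff_eq, hp]
    exact Prod.ext (wreathPerm_single h.1 i 1 fun _ => rfl)
      (wreathPerm_zero _ fun j => hs0 (R⁻¹ j))
  · rw [Equiv.Perm.mul_apply, Equiv.Perm.inv_eq_iff_eq, h3]
    obtain rfl | rfl : c = 1 ∨ c = 2 := by omega
    · rw [hr, hs1]
    · rw [hr', hs2, hrr]

/-- Letter permutations act transitively on the words. -/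
theorem exists_mixedPerm_zero (v : Word n₂ n₃) : ∃ h, mixedPerm n₂ n₃ h 0 = v := by
  refine ⟨(⟨fun i => Equiv.swap 0 (v.1 i), 1⟩, ⟨fun i => Equiv.swap 0 (v.2 i), 1⟩), ?_⟩
  refine Prod.ext (funext fun i => ?_) (funext fun i => ?_) <;>
  simp [mixedPerm_apply, wreathPerm_apply]

/-- After composition with a letter permutation, an isometry fixes the zero word; it then permutes
the words at distance one from it, in the same way as some element of the wreath products does. -/
theorem range_mixedPerm : (mixedPerm n₂ n₃).range = isometryGroup n₂ n₃ := by
  refine le_antisymm (by rintro _ ⟨h, rfl⟩; exact mixedPerm_mem_isometryGroup h) fun g hg => ?_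
  obtain ⟨h, hh⟩ := exists_mixedPerm_zero (g 0)
  have h1 := mem_range_of_fix_zero
    (mul_mem (inv_mem (mixedPerm_mem_isometryGroup h)) hg)
    (by rw [Equiv.Perm.mul_apply, ← hh, ← Equiv.Perm.mul_apply, inv_mul_cancel,
      Equiv.Perm.one_apply])
  exact (Subgroup.mul_mem_cancel_left _ (inv_mem (MonoidHom.mem_range.2 ⟨h, rfl⟩))).1 h1

theorem codeStabilizer_empty : codeStabilizer (∅ : Code n₂ n₃) = isometryGroup n₂ n₃ :=
  Subgroup.ext fun _ => and_iff_left (Finset.map_empty _)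

end Isometries

/-! ### Representative sets from kernel families -/

section Families

variable {𝕜 G X ι : Type*} [RCLike 𝕜] [Group G] [MulAction G X] [Fintype X] {J : ι → Type*}
  [∀ i, Nonempty (J i)] [∀ i, Subsingleton (J i)] {u : ι → X → ℝ}

theorem exists_kernel_refl (G : Type*) {X : Type*} [Group G] [MulAction G X] [Fintype X]
    (f : X → ℝ) : ∃ t : X → X → ℝ, (∀ (g : G) x y, t (g • x) (g • y) = t x y) ∧
      ∀ x, ∑ y, t x y * f y = f x := by
  classical
  exact ⟨fun x y => if x = y then 1 else 0, by simp, by simp⟩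

theorem IsKernelFamily.isRepresentativeSet (hu : IsKernelFamily (fun (g : G) x => g • x) u)
    {U : ∀ i, Matrix X (J i) ℝ} (hU : ∀ i x j, U i x j = u i x) :
    IsRepresentativeSet (permRep 𝕜 G X) fun i => (U i).map fun r : ℝ => (r : 𝕜) := by
  classical
  have : ∀ i, Fintype (J i) := fun i => Fintype.ofFinite _
  have hcol : ∀ i j, (U i).col j = u i := fun i j => funext fun x => hU i x j
  refine isRepresentativeSet_of_kernels (fun i => inferInstance) U (fun _ _ => 1)
    (fun _ _ => one_ne_zero) (fun i j => hcol i j ▸ hu.ne_zero i) ?_ ?_ ?_ ?_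
  · intro i j i' j' hne g
    simp only [hU]
    refine hu.orthogonal i i' ?_ g
    rintro rfl
    exact hne (by rw [Subsingleton.elim j j'])
  · intro i
    obtain ⟨j₀⟩ : Nonempty (J i) := inferInstance
    have : (fun x y => ∑ j, (1 : ℝ) * (U i x j * U i y j)) = fun x y => u i x * u i y := by
      ext x y
      rw [Fintype.sum_subsingleton _ j₀, hU, hU, one_mul]
    rw [this]
    exact hu.kernel i
  · intro y
    refine Submodule.span_mono ?_ (hu.span y)
    rintro _ ⟨⟨i, g⟩, rfl⟩
    obtain ⟨j₀⟩ : Nonempty (J i) := inferInstance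
    exact ⟨⟨⟨i, j₀⟩, g⟩, funext fun x => hU _ _ _⟩
  · intro i j j'
    obtain rfl := Subsingleton.elim j j'
    exact exists_kernel_refl G _

/-- If `Y` is the disjoint union of a fixed point and a copy of `X`, a representative set for `X`
becomes one for `Y` when the unit vector of the fixed point is added to the matrix of the trivial
representation. The sum of the coefficients of the group algebra element of `u i` is its eigenvalue
at the fixed point; by orthogonality to the constant vector `u i₀` it vanishes unless `i = i₀`. -/
theorem IsKernelFamily.isRepresentativeSet_option {Y : Type*} [MulAction G Y] [Fintype Y]
    (hu : IsKernelFamily (fun (g : G) x => g • x) u) {i₀ : ι} (hi₀ : u i₀ = 1)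
    {P : ι → Prop} (hP : ∀ i, P i ↔ i = i₀) (e : Option X ≃ Y)
    (he_none : ∀ g : G, g • e none = e none)
    (he_some : ∀ (g : G) x, g • e (some x) = e (some (g • x)))
    {U : ∀ i, Matrix Y (J i ⊕ PLift (P i)) ℝ}
    (hU₁ : ∀ i j, U i (e none) (.inl j) = 0) (hU₂ : ∀ i j x, U i (e (some x)) (.inl j) = u i x)
    (hU₃ : ∀ i j, U i (e none) (.inr j) = 1) (hU₄ : ∀ i j x, U i (e (some x)) (.inr j) = 0) :
    IsRepresentativeSet (permRep 𝕜 G Y) fun i => (U i).map fun r : ℝ => (r : 𝕜) := by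
  classical
  have : ∀ i, Fintype (J i) := fun i => Fintype.ofFinite _
  have hY : ∀ F : Y → ℝ, ∑ y, F y = F (e none) + ∑ x, F (e (some x)) := fun F => by
    rw [← e.sum_comp, Fintype.sum_option]
  have hX : (Fintype.card X : ℝ) ≠ 0 := by
    obtain ⟨x, -⟩ := Function.ne_iff.1 (hu.ne_zero i₀)
    have : Nonempty X := ⟨x⟩
    exact Nat.cast_ne_zero.2 Fintype.card_ne_zero
  have hsum : ∀ i, ¬P i → ∑ x, u i x = 0 := by
    intro i hi
    have h := hu.orthogonal i i₀ (fun h => hi ((hP i).2 h)) 1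
    simpa [hi₀] using h
  have hu1 : ∀ i, P i → ∀ x, u i x = 1 := by
    intro i hi x
    rw [(hP i).1 hi, hi₀]; rfl
  refine isRepresentativeSet_of_kernels (fun i => inferInstance) U
    (fun i => Sum.elim (fun _ => 1) fun _ => (Fintype.card X : ℝ)) ?_ ?_ ?_ ?_ ?_ ?_
  · rintro i (j | j)
    · exact one_ne_zero
    · exact hX
  · rintro i (j | j) h
    · exact hu.ne_zero i (funext fun x => by
        have := congrFun h (e (some x))
        simpa [hU₂] using this)
    · have := congrFun h (e none)
      simp [hU₃] at this
  · rintro i (j | j) i' (j' | j') hne g <;>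
      simp only [hY, he_none, he_some, hU₁, hU₂, hU₃, hU₄, mul_zero, zero_mul, mul_one, zero_add,
        Finset.sum_const_zero, add_zero]
    · refine hu.orthogonal i i' ?_ g
      rintro rfl
      exact hne (by rw [Subsingleton.elim j j'])
    · obtain rfl := ((hP i).1 j.down).trans ((hP i').1 j'.down).symm
      exact absurd (congrArg _ (congrArg Sum.inr (Subsingleton.elim j j'))) hne
  · intro i
    obtain ⟨j₀⟩ : Nonempty (J i) := inferInstance
    obtain ⟨κ, _, g, a, hk⟩ := hu.kernel i
    obtain ⟨x₀, hx₀⟩ := Function.ne_iff.1 (hu.ne_zero i)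
    have hk' : ∀ x y, u i x * u i y = ∑ s, if g s • y = x then a s else 0 := hk
    have ha : ∑ s, a s = if P i then (Fintype.card X : ℝ) else 0 := by
      have h : ∑ x, u i x * u i x₀ = ∑ s, a s := by
        simp only [hk']
        rw [Finset.sum_comm]
        simp
      rw [← h, ← Finset.sum_mul]
      split_ifs with hi
      · simp [hu1 i hi]
      · rw [hsum i hi, zero_mul]
    refine ⟨κ, ‹_›, g, a, fun x y => ?_⟩
    obtain ⟨x, rfl⟩ := e.surjective x
    obtain ⟨y, rfl⟩ := e.surjective y
    beta_reduce
    rw [Fintype.sum_sum_type, Fintype.sum_subsingleton _ j₀]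
    have hPl : ∀ r : ℝ, ∑ _j : PLift (P i), r = if P i then r else 0 := by
      intro r
      split_ifs with hi
      · rw [Fintype.sum_subsingleton _ ⟨hi⟩]
      · have : IsEmpty (PLift (P i)) := ⟨fun j => hi j.down⟩
        simp
    rcases x with _ | x <;> rcases y with _ | y <;>
      simp only [he_none, he_some, hU₁, hU₂, hU₃, hU₄, mul_zero, zero_mul, mul_one, zero_add,
        Sum.elim_inl, Sum.elim_inr, Finset.sum_const_zero, add_zero, one_mul, hPl, ite_self,
        if_true, e.injective.eq_iff, reduceCtorEq, if_false, Option.some.injEq]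
    · exact ha.symm
    · exact hk' x y
  · have hUi : ∀ i j g, (fun y => U i (g • y) j) ∈ Submodule.span ℝ
        (Set.range fun p : (Σ i, J i ⊕ PLift (P i)) × G => fun y => U p.1.1 (p.2 • y) p.1.2) :=
      fun i j g => Submodule.subset_span ⟨⟨⟨i, j⟩, g⟩, rfl⟩
    intro y
    obtain ⟨y, rfl⟩ := e.surjective y
    rcases y with _ | y
    · convert hUi i₀ (.inr ⟨(hP i₀).2 rfl⟩) 1 using 1
      ext x
      obtain ⟨x, rfl⟩ := e.surjective x
      rcases x with _ | x <;> simp [hU₃, hU₄]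
    · let L : (X → ℝ) →ₗ[ℝ] Y → ℝ :=
        { toFun := fun f y => (e.symm y).elim 0 f
          map_add' := fun f f' => funext fun y => by
            rcases h : e.symm y with _ | x <;> simp [h]
          map_smul' := fun c f => funext fun y => by
            rcases h : e.symm y with _ | x <;> simp [h] }
      have hle : Submodule.span ℝ (Set.range fun p : ι × G => fun x => u p.1 (p.2 • x)) ≤
          (Submodule.span ℝ (Set.range fun p : (Σ i, J i ⊕ PLift (P i)) × G =>
            fun y => U p.1.1 (p.2 • y) p.1.2)).comap L := by
        rw [Submodule.span_le]
        rintro _ ⟨⟨i, g⟩, rfl⟩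
        obtain ⟨j₀⟩ : Nonempty (J i) := inferInstance
        have hL : L (fun x => u i (g • x)) = fun y => U i (g • y) (.inl j₀) := by
          ext x
          obtain ⟨x, rfl⟩ := e.surjective x
          rcases x with _ | x <;> simp [L, he_none, he_some, hU₁, hU₂]
        change L (fun x => u i (g • x)) ∈ Submodule.span ℝ _
        rw [hL]
        exact hUi i _ g
      have h := hle (hu.span y)
      rw [Submodule.mem_comap] at h
      convert h using 1
      ext x
      obtain ⟨x, rfl⟩ := e.surjective x
      rcases x with _ | x <;> simp [L, Pi.single_apply]
  · have hfix : ∀ (g : G) y, g • y = e none ↔ y = e none := fun g y => by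
      rw [smul_eq_iff_eq_inv_smul, he_none]
    rintro i (j | j) (j' | j')
    · obtain rfl := Subsingleton.elim j j'
      exact exists_kernel_refl G _
    · refine ⟨fun x y => if x = e none ∧ y ≠ e none then (Fintype.card X : ℝ)⁻¹ else 0,
        by simp [hfix], fun x => ?_⟩
      obtain ⟨x, rfl⟩ := e.surjective x
      rcases x with _ | x <;> simp [hY, hU₂, hU₃, hU₄, hu1 i j'.down, hX]
    · refine ⟨fun x y => if x ≠ e none ∧ y = e none then 1 else 0, by simp [hfix], fun x => ?_⟩
      obtain ⟨x, rfl⟩ := e.surjective x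
      rcases x with _ | x <;> simp [hY, hU₁, hU₂, hU₃, hu1 i j.down]
    · obtain rfl := Subsingleton.elim j j'
      exact exists_kernel_refl G _

end Families

/-! ### Tableaux with a single letter -/

section Tableaux

/-- A semistandard tableau with a single letter has at most one cell in each column. -/
theorem IsSemistandard.eq_of_col_eq {μ : YoungDiagram} {τ : Tableau μ 1} (hτ : IsSemistandard τ)
    {y y' : μ.cells} (h : y.1.2 = y'.1.2) : y = y' := by
  have hlt : ∀ {y y' : μ.cells}, y.1.2 = y'.1.2 → ¬y.1.1 < y'.1.1 := fun h hlt =>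
    (hτ.2 _ _ h hlt).ne (Subsingleton.elim _ _)
  exact Subtype.ext (Prod.ext (le_antisymm (not_lt.1 (hlt h.symm)) (not_lt.1 (hlt h))) h)

/-- For a semistandard tableau with a single letter, both sums that define the tableau vector have
one term, and the vector is a tensor power of `B(1)`. -/
theorem tableauVector_one {n q : ℕ} {lam : Partn n} {τ : Tableau lam.1 1} (hτ : IsSemistandard τ)
    (B : Fin 1 → Fin q → ℝ) (x : Fin n → Fin q) : tableauVector lam B τ x = ∏ k, B 0 (x k) := by
  classical
  have hc : ∀ c : columnStabilizer lam.1, c = 1 := fun c =>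
    Subtype.ext (Equiv.ext fun y => hτ.eq_of_col_eq (c.2 y))
  unfold tableauVector
  rw [Finset.sum_eq_single τ (fun τ' _ h => absurd (Subsingleton.elim _ _) h)
    fun h => absurd (Finset.mem_filter.2 ⟨Finset.mem_univ _, 1, one_mem _, rfl⟩) h,
    Fintype.sum_eq_single 1 fun c h => absurd (hc c) h]
  simp [Subsingleton.elim (_ : Fin 1) 0]

/-- Only a one-row diagram has a semistandard tableau with a single letter. -/
theorem eq_rowPartn {n : ℕ} {lam : Partn n} {τ : Tableau lam.1 1} (hτ : IsSemistandard τ) :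
    lam = rowPartn n := by
  -- The cell above a cell lies in the same column.
  have hrow : ∀ c ∈ lam.1.cells, c.1 = 0 := by
    rintro ⟨i, j⟩ hc
    have h0 : (0, j) ∈ lam.1.cells := lam.1.isLowerSet (Prod.mk_le_mk.2 ⟨Nat.zero_le i, le_rfl⟩) hc
    exact congrArg (fun y => y.1.1) (hτ.eq_of_col_eq (y := ⟨(i, j), hc⟩) (y' := ⟨(0, j), h0⟩) rfl)
  have hlt : ∀ c ∈ lam.1.cells, c.2 < n := by
    rintro ⟨i, j⟩ hc
    obtain rfl : i = 0 := hrow _ hc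
    have hsub : ({0} : Finset ℕ) ×ˢ Finset.range (j + 1) ⊆ lam.1.cells := by
      rintro ⟨a, b⟩ hab
      simp only [Finset.mem_product, Finset.mem_singleton, Finset.mem_range] at hab
      exact lam.1.isLowerSet (Prod.mk_le_mk.2 ⟨by omega, by omega⟩) hc
    have hcard := Finset.card_le_card hsub
    have hn : lam.1.cells.card = n := lam.2
    rw [hn] at hcard
    simpa using hcard
  refine Subtype.ext (YoungDiagram.ext (Finset.eq_of_subset_of_card_le ?_ ?_))
  · intro c hc
    exact Finset.mem_product.2 ⟨Finset.mem_singleton.2 (hrow c hc), Finset.mem_range.2 (hlt c hc)⟩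
  · exact ((rowPartn n).2.trans lam.2.symm).le

theorem isSemistandard_rowPartn (n : ℕ) (τ : Tableau (rowPartn n).1 1) : IsSemistandard τ := by
  refine ⟨fun _ _ _ _ => (Subsingleton.elim _ _).le, fun y y' _ hlt => ?_⟩
  have h := (Finset.mem_product.1 y'.2).1
  simp only [Finset.mem_singleton] at h
  omega

end Tableaux

/-! ### The block vectors -/

section Blocks

variable {n₂ n₃ : ℕ}

theorem wordVec_add {q : ℕ} (a b : Fin q) {n l l' : ℕ} (h : l + l' = n) (x : Fin n → Fin q) :
    wordVec a b n l x = ∏ k : Fin l', letterVec a b false (x (Fin.cast h (Fin.natAdd l k))) := by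
  subst h
  simp [wordVec, Fin.prod_univ_add, letterVec]

theorem blockVector_eq (p : BlockIndex n₂ n₃) (τ : p.Z) (x : Word n₂ n₃) :
    blockVector p τ x = wordVec 0 1 n₂ p.l₁ x.1 * wordVec 0 1 n₃ p.l₃ x.2 := by
  have hB₂ : B₂ 0 = letterVec 0 1 false := by
    ext c; fin_cases c <;> simp [B₂, letterVec]
  have hB₄ : B₄ 0 = letterVec 0 1 false := by
    ext c; fin_cases c <;> simp [B₄, letterVec]
  have hB₁ : ∀ c, B₁ 0 c = 1 := by intro c; fin_cases c <;> rfl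
  have hB₃ : ∀ c, B₃ 0 c = 1 := by intro c; fin_cases c <;> rfl
  rw [wordVec_add 0 1 p.sum₂, wordVec_add 0 1 p.sum₃, blockVector, tableauVector_one τ.1.2,
    tableauVector_one τ.2.1.2, tableauVector_one τ.2.2.1.2, tableauVector_one τ.2.2.2.2]
  simp [hB₁, hB₂, hB₃, hB₄]

theorem BlockIndex.ext_of_nonempty {p p' : NonemptyBlock n₂ n₃} (h₁ : p.1.l₁ = p'.1.l₁)
    (h₃ : p.1.l₃ = p'.1.l₃) : p = p' := by
  obtain ⟨⟨l₁, l₂, l₃, l₄, s₂, s₃, m₁, m₂, m₃, m₄⟩, ⟨τ⟩⟩ := p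
  obtain ⟨⟨l₁', l₂', l₃', l₄', s₂', s₃', m₁', m₂', m₃', m₄'⟩, ⟨τ'⟩⟩ := p'
  dsimp only at h₁ h₃
  subst h₁ h₃
  obtain rfl : l₂ = l₂' := by omega
  obtain rfl : l₄ = l₄' := by omega
  obtain rfl := (eq_rowPartn τ.1.2).trans (eq_rowPartn τ'.1.2).symm
  obtain rfl := (eq_rowPartn τ.2.1.2).trans (eq_rowPartn τ'.2.1.2).symm
  obtain rfl := (eq_rowPartn τ.2.2.1.2).trans (eq_rowPartn τ'.2.2.1.2).symm
  obtain rfl := (eq_rowPartn τ.2.2.2.2).trans (eq_rowPartn τ'.2.2.2.2).symm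
  rfl

/-- A block with nonempty `Z` consists of four one-row partitions, so it is determined by `l₁` and
`l₃`. -/
noncomputable def nonemptyBlockEquiv (n₂ n₃ : ℕ) :
    NonemptyBlock n₂ n₃ ≃ Fin (n₂ + 1) × Fin (n₃ + 1) :=
  Equiv.ofBijective
    (fun p => (⟨p.1.l₁, by have := p.1.sum₂; omega⟩, ⟨p.1.l₃, by have := p.1.sum₃; omega⟩)) <| by
    constructor
    · intro p p' h
      simp only [Prod.mk.injEq, Fin.mk.injEq] at h
      exact BlockIndex.ext_of_nonempty h.1 h.2
    · rintro ⟨l₁, l₃⟩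
      refine ⟨⟨⟨l₁, n₂ - l₁, l₃, n₃ - l₃, by omega, by omega, rowPartn _, rowPartn _, rowPartn _,
        rowPartn _⟩, ?_⟩, rfl⟩
      exact ⟨⟨fun _ => 0, isSemistandard_rowPartn _ _⟩, ⟨fun _ => 0, isSemistandard_rowPartn _ _⟩,
        ⟨fun _ => 0, isSemistandard_rowPartn _ _⟩, ⟨fun _ => 0, isSemistandard_rowPartn _ _⟩⟩

theorem isKernelFamily_block (n₂ n₃ : ℕ) :
    IsKernelFamily (fun (g : codeStabilizer (∅ : Code n₂ n₃)) (x : Word n₂ n₃) => g • x)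
      fun (p : NonemptyBlock n₂ n₃) x => wordVec 0 1 n₂ p.1.l₁ x.1 * wordVec 0 1 n₃ p.1.l₃ x.2 := by
  have h2 := isKernelFamily_wordVec (q := 2) (a := 0) (b := 1) (by decide) n₂
  have h3 := isKernelFamily_wordVec (q := 3) (a := 0) (b := 1) (by decide) n₃
  refine (h2.prod h3).congr (fun h => ⟨⟨mixedPerm n₂ n₃ h, ?_⟩, rfl⟩) (fun g => ?_)
    (nonemptyBlockEquiv n₂ n₃)
  · have hg : g.1 ∈ (mixedPerm n₂ n₃).range := by
      rw [range_mixedPerm, ← codeStabilizer_empty]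
      exact g.2
    obtain ⟨h, hh⟩ := hg
    exact ⟨h, funext fun x => congrArg (fun σ : Equiv.Perm (Word n₂ n₃) => σ x) hh⟩
  · rw [codeStabilizer_empty]
    exact mixedPerm_mem_isometryGroup h

/-- The codes in `S(∅)` are the empty code and the singletons. -/
noncomputable def optionWordEquiv (n₂ n₃ : ℕ) :
    Option (Word n₂ n₃) ≃ CodeFamily 3 (∅ : Code n₂ n₃) :=
  Equiv.ofBijective
    (fun o => o.elim ⟨∅, by simp⟩ fun v => ⟨{v}, by simp⟩) <| by
    constructor
    · rintro (_ | v) (_ | w) h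
      · rfl
      · exact absurd (congrArg Subtype.val h).symm (Finset.singleton_ne_empty w)
      · exact absurd (congrArg Subtype.val h) (Finset.singleton_ne_empty v)
      · exact congrArg some (Finset.singleton_injective (congrArg Subtype.val h))
    · rintro ⟨C, h1, h2, h3⟩
      have hC : C.card ≤ 1 := by
        simp only [Finset.card_empty, Finset.sdiff_empty] at h3
        omega
      rcases Finset.card_le_one_iff_subset_singleton.1 hC with ⟨v, hv⟩
      rcases Finset.subset_singleton_iff.1 hv with rfl | rfl
      · exact ⟨none, rfl⟩
      · exact ⟨some v, rfl⟩

theorem optionWordEquiv_none (n₂ n₃ : ℕ) : (optionWordEquiv n₂ n₃ none).1 = ∅ := rfl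

theorem optionWordEquiv_some (v : Word n₂ n₃) : (optionWordEquiv n₂ n₃ (some v)).1 = {v} := rfl

/-- The index `((n₂), (), (n₃), ())`, whose matrix is not empty. -/
def invariantBlock (n₂ n₃ : ℕ) : NonemptyBlock n₂ n₃ :=
  ⟨invariantIndex n₂ n₃, ⟨⟨fun _ => 0, isSemistandard_rowPartn _ _⟩,
    ⟨fun _ => 0, isSemistandard_rowPartn _ _⟩, ⟨fun _ => 0, isSemistandard_rowPartn _ _⟩,
    ⟨fun _ => 0, isSemistandard_rowPartn _ _⟩⟩⟩

theorem isRepresentativeSet_blockMatrix (𝕜 : Type*) [RCLike 𝕜] (n₂ n₃ : ℕ) :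
    IsRepresentativeSet (permRep 𝕜 (codeStabilizer (∅ : Code n₂ n₃)) (Word n₂ n₃))
      fun p : NonemptyBlock n₂ n₃ => (blockMatrix p).map fun r : ℝ => (r : 𝕜) := by
  have (p : NonemptyBlock n₂ n₃) : Nonempty p.1.Z := p.2
  exact (isKernelFamily_block n₂ n₃).isRepresentativeSet fun p x τ => blockVector_eq p.1 τ x

theorem isRepresentativeSet_extendedMatrix (𝕜 : Type*) [RCLike 𝕜] (n₂ n₃ : ℕ) :
    IsRepresentativeSet (permRep 𝕜 (codeStabilizer (∅ : Code n₂ n₃))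
        (CodeFamily 3 (∅ : Code n₂ n₃)))
      fun p : NonemptyBlock n₂ n₃ => (extendedMatrix p).map fun r : ℝ => (r : 𝕜) := by
  have (p : NonemptyBlock n₂ n₃) : Nonempty p.1.Z := p.2
  refine (isKernelFamily_block n₂ n₃).isRepresentativeSet_option (i₀ := invariantBlock n₂ n₃)
    (P := fun p => p.1 = invariantIndex n₂ n₃) ?_
    (fun p => (Subtype.ext_iff (a2 := invariantBlock n₂ n₃)).symm)
    (optionWordEquiv n₂ n₃) (fun g => Subtype.ext (Finset.map_empty _))
    (fun g x => Subtype.ext (Finset.map_singleton _ _)) (fun p τ => ?_) (fun p τ x => ?_)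
    (fun p τ => ?_) fun p τ x => ?_
  · ext x
    simp [invariantBlock, invariantIndex, wordVec, letterVec]
  · simp [extendedMatrix, singletonExtension, optionWordEquiv_none,
      fun v : Word n₂ n₃ => (Finset.singleton_ne_empty v).symm]
  · simp [extendedMatrix, singletonExtension, optionWordEquiv_some, blockVector_eq]
  · simp [extendedMatrix, emptyVector, optionWordEquiv_none]
  · simp [extendedMatrix, emptyVector, optionWordEquiv_some]

end Blocks

end MixedCode

theorem mainTheorem3 (n₂ n₃ : ℕ) :
    (MixedCode.codeStabilizer (∅ : MixedCode.Code n₂ n₃) = MixedCode.isometryGroup n₂ n₃ ∧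
      Function.Injective (MixedCode.mixedPerm n₂ n₃) ∧
      (MixedCode.mixedPerm n₂ n₃).range = MixedCode.isometryGroup n₂ n₃) ∧
    MixedCode.IsRealRepresentativeSet
      (MixedCode.codeStabilizer (∅ : MixedCode.Code n₂ n₃)) (MixedCode.Word n₂ n₃)
      (fun p : MixedCode.NonemptyBlock n₂ n₃ => MixedCode.blockMatrix p) ∧
    MixedCode.IsRealRepresentativeSet
      (MixedCode.codeStabilizer (∅ : MixedCode.Code n₂ n₃))
      (MixedCode.CodeFamily 3 (∅ : MixedCode.Code n₂ n₃))
      (fun p : MixedCode.NonemptyBlock n₂ n₃ => MixedCode.extendedMatrix p) := by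
  exact ⟨⟨MixedCode.codeStabilizer_empty, MixedCode.mixedPerm_injective n₂ n₃,
      MixedCode.range_mixedPerm⟩,
    ⟨MixedCode.isRepresentativeSet_blockMatrix ℝ n₂ n₃,
      MixedCode.isRepresentativeSet_blockMatrix ℂ n₂ n₃⟩,
    ⟨MixedCode.isRepresentativeSet_extendedMatrix ℝ n₂ n₃,
      MixedCode.isRepresentativeSet_extendedMatrix ℂ n₂ n₃⟩⟩
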